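/- Let $f_0,f_1$ be probability densities with respect to a $\sigma$-finite measure $\nu$ whose Kullback–Leibler divergences $I_0=\int \log(f_0/f_1)\,f_0\,d\nu$ and $I_1=\int\log(f_1/f_0)\,f_1\,d\nu$ are positive and finite. For $i\in\{0,1\}$ let $\mathsf P_i$ be the law of an i.i.d. sequence $X=(X_n)_{n\ge1}$ with density $f_i$, let $\mathsf E_i$ be the corresponding expectation, and for $\pi\in[0,1]$ let $\mathsf E_\pi$ be the expectation under $(1-\pi)\mathsf P_0+\pi\mathsf P_1$. A *test* is a pair $(T,D)$, where $T$ is a stopping time of the filtration $\mathcal F_n=\sigma(X_1,\dots,X_n)$, $n\ge 1$, with values in $\{1,2,\dots\}\cup\{\infty\}$, and $D$ is a $\{0,1\}$-valued random variable with $\{T=n,D=i\}\in\mathcal F_n$ for all $n\ge1$ and $i\in\{0,1\}$. For $\alpha,\beta\in(0,1)$ let $\mathcal E(\alpha,\beta)$ be the set of tests with $\mathsf P_0(D=1)\le\alpha$ and $\mathsf P_1(D=0)\le\beta$, and put $\mathcal L_\pi(\alpha,\beta)=\inf_{(T,D)\in\mathcal E(\alpha,\beta)}\mathsf E_\pi[T]$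 for $\pi\in[0,1]$. Let $l_m,u_m,\kappa_m,\iota_m$ ($m\in\mathbb N$) be nonnegative integers such that, for all sufficiently large $m$, $l_m\le u_m\le m$, $1\le\iota_m<u_m$ and $1\le\kappa_m<m-l_m$. Let $\mathsf B(n,p;k)$ be the probability that a Binomial$(n,p)$ variable is at least $k$. For $\alpha,\beta\in(0,1/2)$, let $\alpha_m^G$ be the largest $p\in(0,1)$ with $\mathsf B(m-l_m,p;\kappa_m)\le\alpha$, and $\beta_m^G$ the largest $p\in(0,1)$ with $\mathsf B(u_m,p;\iota_m)\le\beta$ (these are the individual levels that correspond to controlling at $\alpha$ and $\beta$ the probabilities of at least $\kappa_m$ type-I errors and of at least $\iota_m$ type-II errors when the same test is applied to $m$ independent streams, of which at least $l_m$ and at most $u_m$ are signals). Positive quantities satisfy $x_m(s)\sim y_m(s)$ uniformly in $s\in\{l_m,\dots,u_m\}$ if $\max_{l_m\le s\le u_m}|x_m(s)/y_m(s)-1|\to0$ as $m\to\infty$, and $x_m\ll y_m$ means $x_m/y_m\to0$. Let $\chi^*=\{(T^*(\alpha,\beta),D^*(\alpha,\beta))\in\mathcal E(\alpha,\beta):\alpha,\beta\in(0,1)\}$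 be a family of tests. It is called *asymptotically optimal in the high-dimensional sense under generalized error control* if, for all $\alpha,\beta\in(0,1/2)$, $\mathsf E_{s/m}[T^*(\alpha_m^G,\beta_m^G)]\sim\mathcal L_{s/m}(\alpha_m^G,\beta_m^G)$ uniformly in $s\in\{l_m,\dots,u_m\}$. **Theorem.** Suppose that, as $m\to\infty$, $u_m\to\infty$, $m-l_m\to\infty$, $\iota_m\ll u_m$ and $\kappa_m\ll m-l_m$. (i) For all $\alpha,\beta\in(0,1/2)$, uniformly in $s\in\{l_m,\dots,u_m\}$, $$\mathcal L_{s/m}(\alpha_m^G,\beta_m^G)\sim\Big(1-\frac sm\Big)\frac{\log(u_m/\iota_m)}{I_0}+\frac sm\,\frac{\log((m-l_m)/\kappa_m)}{I_1}.$$ (ii) If, for all $\alpha,\beta\in(0,1/2)$, $\mathsf E_0[T^*(\alpha_m^G,\beta_m^G)]\sim\mathcal L_0(\alpha_m^G,\beta_m^G)$ and $\mathsf E_1[T^*(\alpha_m^G,\beta_m^G)]\sim\mathcal L_1(\alpha_m^G,\beta_m^G)$, then $\chi^*$ is asymptotically optimal in the high-dimensional sense under generalized error control. (iii) If, for all $\alpha,\beta\in(0,1/2)$,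 $\mathsf E_0[T^*(\alpha_m^G,\beta_m^G)]\sim\mathcal L_0(\alpha_m^G,\beta_m^G)$ and $$\mathsf E_1[T^*(\alpha_m^G,\beta_m^G)]\ll\frac{(m-u_m)\log(u_m/\iota_m)}{u_m}$$ (in particular $u_m<m$ for all large $m$), then $\chi^*$ is asymptotically optimal in the high-dimensional sense under generalized error control. -/

import Mathlib

open MeasureTheory Filter Topology
open scoped ENNReal

noncomputable section

/-- The `σ`-algebra generated by the first `n` observations of a sequence `ω 0, ω 1, …`
(the `n`-th observation of the sequence is `ω (n - 1)`). -/
abbrev obsSigma (E : Type*) [MeasurableSpace E] (n : ℕ) : MeasurableSpace (ℕ → E) :=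
  ⨆ i : Fin n, MeasurableSpace.comap (fun ω : ℕ → E => ω i) inferInstance

/-- A sequential test: a stopping time `T` with values in `{1, 2, …} ∪ {∞}` and a binary random
variable `D` (`true` means that the null hypothesis is rejected) that is determined by the
observations collected up to time `T`. -/
structure SeqTest (E : Type*) [MeasurableSpace E] where
  T : (ℕ → E) → ℕ∞
  D : (ℕ → E) → Bool
  one_le_T : ∀ ω, 1 ≤ T ω
  measurable_D : Measurable D
  measurableSet_T : ∀ n : ℕ, 1 ≤ n → MeasurableSet[obsSigma E n] {ω | T ω = n}
  measurableSet_T_D : ∀ n : ℕ, 1 ≤ n → ∀ i : Bool,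
    MeasurableSet[obsSigma E n] {ω | T ω = n ∧ D ω = i}

/-- The law of an iid sequence with common law `μ`. -/
def iidLaw {E : Type*} [MeasurableSpace E] (μ : Measure E) [IsProbabilityMeasure μ] :
    Measure (ℕ → E) :=
  Measure.infinitePi (fun _ : ℕ => μ)

/-- The mixture `(1 - π) P₀ + π P₁` of the laws of the iid sequences with marginals `μ₀`, `μ₁`. -/
def mixLaw {E : Type*} [MeasurableSpace E] (μ₀ μ₁ : Measure E) [IsProbabilityMeasure μ₀]
    [IsProbabilityMeasure μ₁] (π : ℝ) : Measure (ℕ → E) :=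
  ENNReal.ofReal (1 - π) • iidLaw μ₀ + ENNReal.ofReal π • iidLaw μ₁

/-- The expected sample size of a test when the sequence of observations has law `Q`. -/
def SeqTest.ess {E : Type*} [MeasurableSpace E] (χ : SeqTest E) (Q : Measure (ℕ → E)) : ℝ≥0∞ :=
  ∫⁻ ω, (χ.T ω : ℝ≥0∞) ∂Q

/-- The class of tests of `μ₀` against `μ₁` with type-I error probability at most `α` and type-II
error probability at most `β`. -/
def testClass {E : Type*} [MeasurableSpace E] (μ₀ μ₁ : Measure E) [IsProbabilityMeasure μ₀]
    [IsProbabilityMeasure μ₁] (α β : ℝ) : Set (SeqTest E) :=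
  {χ | iidLaw μ₀ {ω | χ.D ω = true} ≤ ENNReal.ofReal α ∧
    iidLaw μ₁ {ω | χ.D ω = false} ≤ ENNReal.ofReal β}

/-- The optimal expected sample size under `Q` among the tests in `testClass μ₀ μ₁ α β`. -/
def optESS {E : Type*} [MeasurableSpace E] (μ₀ μ₁ : Measure E) [IsProbabilityMeasure μ₀]
    [IsProbabilityMeasure μ₁] (Q : Measure (ℕ → E)) (α β : ℝ) : ℝ≥0∞ :=
  ⨅ χ ∈ testClass μ₀ μ₁ α β, χ.ess Q

/-- The probability that a binomial random variable with parameters `n`, `p` is at least `k`. -/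
def binomTail (n : ℕ) (p : ℝ) (k : ℕ) : ℝ :=
  ∑ j ∈ Finset.Icc k n, (n.choose j : ℝ) * p ^ j * (1 - p) ^ (n - j)

/-- The largest `p ∈ (0, 1)` such that `binomTail n p k ≤ α`; see `isGreatest_binomLevel`. -/
def binomLevel (n k : ℕ) (α : ℝ) : ℝ :=
  sSup {p : ℝ | p ∈ Set.Ioo (0 : ℝ) 1 ∧ binomTail n p k ≤ α}

theorem isGreatest_binomLevel (n k : ℕ) (α : ℝ) (hk : 1 ≤ k) (hkn : k ≤ n)
    (hα : α ∈ Set.Ioo (0 : ℝ) 1) :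
    IsGreatest {p : ℝ | p ∈ Set.Ioo (0 : ℝ) 1 ∧ binomTail n p k ≤ α} (binomLevel n k α) := by
  have hc : Continuous fun p : ℝ => binomTail n p k := by
    unfold binomTail; fun_prop
  have h0 : binomTail n 0 k = 0 := by
    unfold binomTail
    refine Finset.sum_eq_zero fun j hj => ?_
    have : j ≠ 0 := by have := (Finset.mem_Icc.1 hj).1; omega
    simp [this]
  have h1 : binomTail n 1 k = 1 := by
    unfold binomTail
    rw [Finset.sum_eq_single n]
    · simp
    · intro j hj hjn
      have : n - j ≠ 0 := by have := (Finset.mem_Icc.1 hj).2; omega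
      simp [this]
    · intro h; exact absurd (Finset.mem_Icc.2 ⟨hkn, le_rfl⟩) h
  have hcomp : IsCompact (Set.Icc (0 : ℝ) 1 ∩ {p | binomTail n p k ≤ α}) :=
    isCompact_Icc.inter_right (isClosed_le hc continuous_const)
  obtain ⟨q, ⟨hq01, hq⟩, hmax⟩ := hcomp.exists_isGreatest
    ⟨0, ⟨le_rfl, zero_le_one⟩, by simp [h0, hα.1.le]⟩
  have hsmall : ∃ p ∈ Set.Ioo (0 : ℝ) 1, binomTail n p k ≤ α := by
    have h2 : ∀ᶠ p in 𝓝[>] (0 : ℝ), binomTail n p k < α :=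
      (hc.continuousAt.tendsto.mono_left nhdsWithin_le_nhds).eventually_lt_const
        (by rw [h0]; exact hα.1)
    have h3 : ∀ᶠ p in 𝓝[>] (0 : ℝ), p ∈ Set.Ioo (0 : ℝ) 1 := Ioo_mem_nhdsGT one_pos
    obtain ⟨p, hp, hp'⟩ := (h2.and h3).exists
    exact ⟨p, hp', hp.le⟩
  have hgr : IsGreatest {p : ℝ | p ∈ Set.Ioo (0 : ℝ) 1 ∧ binomTail n p k ≤ α} q := by
    refine ⟨⟨⟨?_, lt_of_le_of_ne hq01.2 ?_⟩, hq⟩, ?_⟩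
    · obtain ⟨p, hp, hp'⟩ := hsmall
      exact hp.1.trans_le (hmax ⟨⟨hp.1.le, hp.2.le⟩, hp'⟩)
    · rintro rfl
      have : binomTail n 1 k ≤ α := hq
      rw [h1] at this
      exact absurd hα.2 (not_lt.2 this)
    · rintro p ⟨hp, hp'⟩
      exact hmax ⟨⟨hp.1.le, hp.2.le⟩, hp'⟩
  rw [binomLevel, hgr.csSup_eq]
  exact hgr

/-- `x m s ∼ y m s` as `m → ∞`, uniformly in `s ∈ {l m, …, u m}`. -/
def UnifEquiv (l u : ℕ → ℕ) (x y : ℕ → ℕ → ℝ≥0∞) : Prop :=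
  ∀ ε : ℝ, 0 < ε → ∀ᶠ m in atTop, ∀ s : ℕ, l m ≤ s → s ≤ u m →
    ENNReal.ofReal (1 - ε) ≤ x m s / y m s ∧ x m s / y m s ≤ ENNReal.ofReal (1 + ε)

/-- The level `α_m^G` for the type-I error of each individual test, for the control at level `α`
of the probability of at least `κ m` type-I errors. -/
def alphaG (l κ : ℕ → ℕ) (α : ℝ) (m : ℕ) : ℝ := binomLevel (m - l m) (κ m) α

/-- The level `β_m^G` for the type-II error of each individual test, for the control at level `β`
of the probability of at least `ι m` type-II errors. -/
def betaG (u ι : ℕ → ℕ) (β : ℝ) (m : ℕ) : ℝ := binomLevel (u m) (ι m) β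

/-- Asymptotic optimality of a family of tests in the high-dimensional sense under generalized
error control. -/
def HighDimOptimal {E : Type*} [MeasurableSpace E] (μ₀ μ₁ : Measure E) [IsProbabilityMeasure μ₀]
    [IsProbabilityMeasure μ₁] (l u κ ι : ℕ → ℕ) (χ : ℝ → ℝ → SeqTest E) : Prop :=
  ∀ α ∈ Set.Ioo (0 : ℝ) (1 / 2), ∀ β ∈ Set.Ioo (0 : ℝ) (1 / 2),
    UnifEquiv l u
      (fun m s => (χ (alphaG l κ α m) (betaG u ι β m)).ess (mixLaw μ₀ μ₁ ((s : ℝ) / m)))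
      (fun m s => optESS μ₀ μ₁ (mixLaw μ₀ μ₁ ((s : ℝ) / m)) (alphaG l κ α m) (betaG u ι β m))

end

/-! Let `Z = log (f₀ / f₁)` and let `S n` be the random walk with steps `Z`; it has drift `I₀` under
`P₀` and `-I₁` under `P₁`, and `exp (-S n)` is the density of `P₁` with respect to `P₀` on the first
`n` observations.

Lower bound (`SeqTest.le_ess`): the change of measure at `T ∧ N`, the inequality `1 + x ≤ exp x` and
Wald's identity give `I₀ E₀[T] ≥ (1 - α) log (1 / β) - 1` for every test with errors at most `α`,
`β`. Exchanging the hypotheses gives the bound for `I₁ E₁[T]`.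

Upper bound (`exists_mem_testClass_ess_le`): the sequential probability ratio test with boundaries
`-log (1 / α)` and `log (1 / β)` meets the error constraints, and its expected sample sizes match
these bounds up to a factor `1 + ε` and an additive constant. Truncating the steps from above
controls the overshoot, so integrability of `Z` suffices.

One test is thus nearly optimal under both hypotheses at once (`ESSBounds`). Expected sample sizes
are linear in the mixture weight, so the optimal value for every mixture is nearly the convex
combination of the two extreme values, with relative error not depending on the weight; this is the
uniformity in `s`.

The inequalities of Markov and Chebyshev place the binomial level between `α k / n` and `4 k / n`,
so its log-inverse is equivalent to `log (n / k)`, which tends to infinity and absorbs all additive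
constants (`tendsto_log_binomLevel`). In (iii), the condition on `E₁[T*]` makes its weighted
contribution negligible against the `P₀` term for every `s ≤ u` (`div_mul_sub_mul_div_le`). -/

/-! ### Finitely many observations: independence and change of measure -/

section ObservationSigmaAlgebra

variable {E : Type*} [MeasurableSpace E]

instance isProbabilityMeasure_iidLaw (μ : Measure E) [IsProbabilityMeasure μ] :
    IsProbabilityMeasure (iidLaw μ) := by
  unfold iidLaw; infer_instance

theorem obsSigma_le (n : ℕ) : obsSigma E n ≤ MeasurableSpace.pi :=
  iSup_le fun i => (measurable_pi_apply (i : ℕ)).comap_le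

theorem obsSigma_mono {k n : ℕ} (h : k ≤ n) : obsSigma E k ≤ obsSigma E n :=
  iSup_le fun i => le_iSup_of_le (⟨i, i.2.trans_le h⟩ : Fin n) le_rfl

theorem obsSigma_eq_comap (n : ℕ) :
    obsSigma E n = MeasurableSpace.comap (fun (ω : ℕ → E) (i : Fin n) => ω i) inferInstance := by
  simp only [obsSigma, MeasurableSpace.pi, MeasurableSpace.comap_iSup,
    MeasurableSpace.comap_comp]
  rfl

theorem measurable_obsSigma_sum {Z : E → ℝ} (hZ : Measurable Z) (n : ℕ) :
    Measurable[obsSigma E n] fun ω : ℕ → E => ∑ i ∈ Finset.range n, Z (ω i) := by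
  rw [obsSigma_eq_comap]
  have h : (fun ω : ℕ → E => ∑ i ∈ Finset.range n, Z (ω i)) =
      (fun x : Fin n → E => ∑ i, Z (x i)) ∘ fun (ω : ℕ → E) (i : Fin n) => ω i := by
    funext ω
    simp [Finset.sum_range]
  rw [h]
  exact (Finset.measurable_sum _ fun i _ => hZ.comp (measurable_pi_apply i)).comp
    (comap_measurable _)

theorem indep_obsSigma (μ : Measure E) [IsProbabilityMeasure μ] (n : ℕ) :
    ProbabilityTheory.Indep (obsSigma E n)
      (MeasurableSpace.comap (fun ω : ℕ → E => ω n) inferInstance) (iidLaw μ) := by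
  have h : ProbabilityTheory.iIndepFun (fun (i : ℕ) (ω : ℕ → E) => ω i) (iidLaw μ) :=
    ProbabilityTheory.iIndepFun_infinitePi (X := fun _ x => x) fun _ => measurable_id
  have hd : Disjoint (Set.Iio n) ({n} : Set ℕ) := by simp
  have h1 := ProbabilityTheory.indep_iSup_of_disjoint
    (fun i => (measurable_pi_apply i).comap_le) h.iIndep hd
  simp only [Set.mem_singleton_iff, iSup_iSup_eq_left] at h1
  refine ProbabilityTheory.indep_of_indep_of_le_left h1 (iSup_le fun i => ?_)
  exact le_iSup₂_of_le (i : ℕ) i.2 le_rfl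

/-- Coordinate `n`, counted from `0`, is the first one not seen by `obsSigma E n`, hence independent
of `A`. With `A = {n < T}` this is one summand of Wald's identity. -/
theorem setIntegral_eval_of_measurableSet_obsSigma (μ : Measure E) [IsProbabilityMeasure μ]
    {Z : E → ℝ} (hZ : Measurable Z) (n : ℕ) {A : Set (ℕ → E)}
    (hA : MeasurableSet[obsSigma E n] A) :
    ∫ ω in A, Z (ω n) ∂iidLaw μ = (iidLaw μ).real A * ∫ x, Z x ∂μ := by
  rw [ProbabilityTheory.Indep.setIntegral_eq_mul (obsSigma_le n) (indep_obsSigma μ n)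
    (measurable_pi_apply n).aemeasurable hA hZ.aestronglyMeasurable]
  congr 1
  rw [← integral_map (φ := fun ω : ℕ → E => ω n) (measurable_pi_apply n).aemeasurable
    hZ.aestronglyMeasurable]
  unfold iidLaw
  rw [Measure.infinitePi_map_eval]

theorem integrable_eval_iidLaw (μ : Measure E) [IsProbabilityMeasure μ] {Z : E → ℝ}
    (hZ : Integrable Z μ) (n : ℕ) : Integrable (fun ω : ℕ → E => Z (ω n)) (iidLaw μ) :=
  (measurePreserving_eval_infinitePi (fun _ : ℕ => μ) n).integrable_comp_of_integrable hZ

/-- Change of measure on the `σ`-algebra of the first `n` observations. -/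
theorem iidLaw_apply_eq_setLIntegral {μ₀ μ₁ : Measure E} [IsProbabilityMeasure μ₀]
    [IsProbabilityMeasure μ₁] {g : E → ℝ≥0∞} (hg : Measurable g) (h : μ₁ = μ₀.withDensity g)
    {n : ℕ} {A : Set (ℕ → E)} (hA : MeasurableSet[obsSigma E n] A) :
    iidLaw μ₁ A = ∫⁻ ω in A, ∏ i : Fin n, g (ω i) ∂iidLaw μ₀ := by
  have hr : Measurable fun (ω : ℕ → E) (i : Fin n) => ω i := by fun_prop
  have hG : Measurable fun ω : ℕ → E => ∏ i : Fin n, g (ω i) := by fun_prop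
  rw [obsSigma_eq_comap] at hA
  obtain ⟨B, hB, rfl⟩ := hA
  have h1 : (iidLaw μ₁).map (fun (ω : ℕ → E) (i : Fin n) => ω i) =
      Measure.pi fun _ : Fin n => μ₁ := by
    unfold iidLaw
    rw [Measure.map_infinitePi_infinitePi_of_inj (P := fun _ : ℕ => μ₁)
      (f := fun i : Fin n => (i : ℕ)) Fin.val_injective, Measure.infinitePi_eq_pi]
  -- A finite product measure is determined by rectangles, on which the integral of the product
  -- density factorizes by independence.
  have h2 : (Measure.pi fun _ : Fin n => μ₁) =
      ((iidLaw μ₀).withDensity fun ω => ∏ i : Fin n, g (ω i)).map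
        (fun (ω : ℕ → E) (i : Fin n) => ω i) := by
    refine Measure.pi_eq fun s hs => ?_
    have hms : MeasurableSet (Set.univ.pi s) := MeasurableSet.univ_pi hs
    rw [Measure.map_apply hr hms, withDensity_apply _ (hr hms),
      ← lintegral_indicator (hr hms)]
    have hind : ProbabilityTheory.iIndepFun
        (fun (i : Fin n) (ω : ℕ → E) => (s i).indicator g (ω i)) (iidLaw μ₀) := by
      have h0 : ProbabilityTheory.iIndepFun (fun (i : ℕ) (ω : ℕ → E) => ω i) (iidLaw μ₀) :=
        ProbabilityTheory.iIndepFun_infinitePi (X := fun _ x => x) fun _ => measurable_id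
      exact (h0.precomp (g := fun i : Fin n => (i : ℕ)) Fin.val_injective).comp
        (fun i => (s i).indicator g) fun i => hg.indicator (hs i)
    have hpt : ∀ ω : ℕ → E, ((fun (ω : ℕ → E) (i : Fin n) => ω i) ⁻¹' Set.univ.pi s).indicator
        (fun ω : ℕ → E => ∏ i : Fin n, g (ω i)) ω =
        ∏ i : Fin n, (s i).indicator g (ω i) := by
      intro ω
      by_cases hω : ∀ i : Fin n, ω i ∈ s i
      · rw [Set.indicator_of_mem (by simpa using hω)]
        exact Finset.prod_congr rfl fun i _ => (Set.indicator_of_mem (hω i) _).symm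
      · rw [Set.indicator_of_notMem (by simpa using hω)]
        obtain ⟨i, hi⟩ := not_forall.1 hω
        exact (Finset.prod_eq_zero (Finset.mem_univ i) (Set.indicator_of_notMem hi _)).symm
    rw [lintegral_congr hpt,
      ProbabilityTheory.lintegral_prod_eq_prod_lintegral_of_indepFun Finset.univ _ hind
        fun i => (hg.indicator (hs i)).comp (measurable_pi_apply _)]
    refine Finset.prod_congr rfl fun i _ => ?_
    rw [h, withDensity_apply _ (hs i), ← lintegral_indicator (hs i)]
    exact (measurePreserving_eval_infinitePi (fun _ : ℕ => μ₀) i).lintegral_comp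
      (hg.indicator (hs i))
  rw [← Measure.map_apply hr hB, h1, h2, Measure.map_apply hr hB, withDensity_apply _ (hr hB)]

theorem iidLaw_apply_eq_setLIntegral_exp {μ₀ μ₁ : Measure E} [IsProbabilityMeasure μ₀]
    [IsProbabilityMeasure μ₁] {Z : E → ℝ} (hZ : Measurable Z)
    (h : μ₁ = μ₀.withDensity fun x => ENNReal.ofReal (Real.exp (-Z x)))
    {n : ℕ} {A : Set (ℕ → E)} (hA : MeasurableSet[obsSigma E n] A) :
    iidLaw μ₁ A =
      ∫⁻ ω in A, ENNReal.ofReal (Real.exp (-∑ i ∈ Finset.range n, Z (ω i))) ∂iidLaw μ₀ := by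
  rw [iidLaw_apply_eq_setLIntegral (by fun_prop) h hA]
  refine lintegral_congr fun ω => ?_
  rw [← ENNReal.ofReal_prod_of_nonneg fun i _ => (Real.exp_pos _).le, ← Real.exp_sum,
    Finset.sum_neg_distrib, Finset.sum_range]

end ObservationSigmaAlgebra

/-! ### Stopped random walks: Wald's identity, change of measure, hitting times -/

section StoppedSum

variable {E : Type*}

/-- The random walk with steps `Z (ω 0), Z (ω 1), …`, stopped at the time `T ∧ N`. -/
noncomputable def stoppedSum (T : (ℕ → E) → ℕ∞) (Z : E → ℝ) (N : ℕ) (ω : ℕ → E) : ℝ :=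
  ∑ k ∈ Finset.range N, {ω | (k : ℕ∞) < T ω}.indicator (fun ω => Z (ω k)) ω

theorem stoppedSum_of_le {T : (ℕ → E) → ℕ∞} {Z : E → ℝ} {N : ℕ} {ω : ℕ → E}
    (h : (N : ℕ∞) ≤ T ω) : stoppedSum T Z N ω = ∑ k ∈ Finset.range N, Z (ω k) := by
  refine Finset.sum_congr rfl fun k hk => Set.indicator_of_mem ?_ _
  exact lt_of_lt_of_le (by exact_mod_cast Finset.mem_range.1 hk) h

theorem stoppedSum_of_eq {T : (ℕ → E) → ℕ∞} {Z : E → ℝ} {n N : ℕ} {ω : ℕ → E}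
    (h : T ω = n) (hn : n ≤ N) : stoppedSum T Z N ω = ∑ k ∈ Finset.range n, Z (ω k) := by
  rw [← stoppedSum_of_le h.ge]
  refine (Finset.sum_subset (Finset.range_mono hn) fun k _ hk => ?_).symm
  refine Set.indicator_of_notMem ?_ _
  simp only [Set.mem_ofPred_eq, h, Nat.cast_lt]
  simpa using hk

/-- Before its last step the walk is still below `b`, and the last truncated step adds at most `c`:
the overshoot is bounded. -/
theorem stoppedSum_min_le {T : (ℕ → E) → ℕ∞} {Z : E → ℝ} {b c : ℝ} (hb : 0 ≤ b) (hc : 0 ≤ c)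
    (hTb : ∀ ω, ∀ k : ℕ, 1 ≤ k → (k : ℕ∞) < T ω → ∑ i ∈ Finset.range k, Z (ω i) < b)
    (N : ℕ) (ω : ℕ → E) : stoppedSum T (fun x => min (Z x) c) N ω ≤ b + c := by
  induction N with
  | zero => simp only [stoppedSum, Finset.range_zero, Finset.sum_empty]; positivity
  | succ N ih =>
    by_cases h : (N : ℕ∞) < T ω
    · have h1 : ((N + 1 : ℕ) : ℕ∞) ≤ T ω := by
        push_cast
        exact Order.add_one_le_of_lt h
      rw [stoppedSum_of_le h1, Finset.sum_range_succ]
      refine add_le_add ?_ (min_le_right _ _)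
      rcases Nat.eq_zero_or_pos N with rfl | hN
      · simpa using hb
      · exact (Finset.sum_le_sum fun i _ => min_le_left _ _).trans (hTb ω N hN h).le
    · have h1 : stoppedSum T (fun x => min (Z x) c) (N + 1) ω =
          stoppedSum T (fun x => min (Z x) c) N ω := by
        unfold stoppedSum
        rw [Finset.sum_range_succ, Set.indicator_of_notMem (by simpa using h), add_zero]
      rw [h1]
      exact ih

variable [MeasurableSpace E]

theorem integrable_indicator_eval (μ : Measure E) [IsProbabilityMeasure μ] {T : (ℕ → E) → ℕ∞}
    (hT : ∀ n : ℕ, MeasurableSet[obsSigma E n] {ω | (n : ℕ∞) < T ω}) {Z : E → ℝ}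
    (hZ : Integrable Z μ) (k : ℕ) :
    Integrable ({ω | (k : ℕ∞) < T ω}.indicator fun ω => Z (ω k)) (iidLaw μ) :=
  (integrable_eval_iidLaw μ hZ k).indicator (obsSigma_le k _ (hT k))

theorem integrable_stoppedSum (μ : Measure E) [IsProbabilityMeasure μ] {T : (ℕ → E) → ℕ∞}
    (hT : ∀ n : ℕ, MeasurableSet[obsSigma E n] {ω | (n : ℕ∞) < T ω}) {Z : E → ℝ}
    (hZ : Integrable Z μ) (N : ℕ) : Integrable (stoppedSum T Z N) (iidLaw μ) :=
  integrable_finsetSum _ fun k _ => integrable_indicator_eval μ hT hZ k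

theorem measurable_stoppedSum {T : (ℕ → E) → ℕ∞}
    (hT : ∀ n : ℕ, MeasurableSet[obsSigma E n] {ω | (n : ℕ∞) < T ω}) {Z : E → ℝ}
    (hZ : Measurable Z) (N : ℕ) : Measurable (stoppedSum T Z N) :=
  Finset.measurable_sum _ fun k _ =>
    (hZ.comp (measurable_pi_apply k)).indicator (obsSigma_le k _ (hT k))

/-- Wald's identity for the bounded stopping time `T ∧ N`. -/
theorem integral_stoppedSum (μ : Measure E) [IsProbabilityMeasure μ] {T : (ℕ → E) → ℕ∞}
    (hT : ∀ n : ℕ, MeasurableSet[obsSigma E n] {ω | (n : ℕ∞) < T ω}) {Z : E → ℝ}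
    (hZm : Measurable Z) (hZ : Integrable Z μ) (N : ℕ) :
    ∫ ω, stoppedSum T Z N ω ∂iidLaw μ =
      (∑ k ∈ Finset.range N, (iidLaw μ).real {ω | (k : ℕ∞) < T ω}) * ∫ x, Z x ∂μ := by
  unfold stoppedSum
  rw [integral_finsetSum _ fun k _ => integrable_indicator_eval μ hT hZ k, Finset.sum_mul]
  refine Finset.sum_congr rfl fun k _ => ?_
  rw [integral_indicator (obsSigma_le k _ (hT k)),
    setIntegral_eval_of_measurableSet_obsSigma μ hZm k (hT k)]

/-- Change of measure at the bounded stopping time `T ∧ N`. -/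
theorem setLIntegral_exp_neg_stoppedSum {μ₀ μ₁ : Measure E} [IsProbabilityMeasure μ₀]
    [IsProbabilityMeasure μ₁] {Z : E → ℝ} (hZ : Measurable Z)
    (h : μ₁ = μ₀.withDensity fun x => ENNReal.ofReal (Real.exp (-Z x)))
    {T : (ℕ → E) → ℕ∞} {N : ℕ} {B : Set (ℕ → E)}
    (hB : ∀ n ≤ N, MeasurableSet[obsSigma E n] {ω | T ω = n ∧ ω ∈ B})
    (hBN : MeasurableSet[obsSigma E N] {ω | (N : ℕ∞) < T ω ∧ ω ∈ B}) :
    ∫⁻ ω in B, ENNReal.ofReal (Real.exp (-stoppedSum T Z N ω)) ∂iidLaw μ₀ = iidLaw μ₁ B := by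
  -- Partition by the value of `T ∧ N`: on each piece `stoppedSum` is a sum over a fixed number of
  -- steps, and the change of measure for that number applies.
  have hdec : B = (⋃ n ∈ Finset.range (N + 1), {ω | T ω = n ∧ ω ∈ B}) ∪
      {ω | (N : ℕ∞) < T ω ∧ ω ∈ B} := by
    ext ω
    simp only [Set.mem_union, Set.mem_iUnion, Set.mem_ofPred_eq, Finset.mem_range, exists_prop]
    constructor
    · intro hω
      rcases lt_or_ge (N : ℕ∞) (T ω) with hlt | hle
      · exact Or.inr ⟨hlt, hω⟩
      · obtain ⟨n, hn⟩ := ENat.ne_top_iff_exists.1 (ne_top_of_le_ne_top (ENat.natCast_ne_top N) hle)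
        rw [← hn] at hle
        exact Or.inl ⟨n, Nat.lt_succ_of_le (by exact_mod_cast hle), hn.symm, hω⟩
    · rintro (⟨n, -, -, hω⟩ | ⟨-, hω⟩) <;> exact hω
  have hpd : (↑(Finset.range (N + 1)) : Set ℕ).PairwiseDisjoint
      fun n : ℕ => {ω | T ω = n ∧ ω ∈ B} := by
    intro i _ j _ hij
    refine Set.disjoint_left.2 fun ω h1 h2 => hij ?_
    exact_mod_cast h1.1.symm.trans h2.1
  have hm : ∀ n ∈ Finset.range (N + 1), MeasurableSet {ω | T ω = n ∧ ω ∈ B} := fun n hn =>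
    obsSigma_le n _ (hB n (Nat.lt_succ_iff.1 (Finset.mem_range.1 hn)))
  have hmN := obsSigma_le N _ hBN
  have hdisj : Disjoint (⋃ n ∈ Finset.range (N + 1), {ω | T ω = n ∧ ω ∈ B})
      {ω | (N : ℕ∞) < T ω ∧ ω ∈ B} := by
    refine Set.disjoint_left.2 fun ω h1 h2 => ?_
    simp only [Set.mem_iUnion, Set.mem_ofPred_eq, Finset.mem_range, exists_prop] at h1
    obtain ⟨n, hn, hTn, -⟩ := h1
    have := h2.1
    rw [hTn, Nat.cast_lt] at this
    omega
  conv_rhs => rw [hdec]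
  conv_lhs => rw [hdec]
  rw [lintegral_union hmN hdisj, measure_union hdisj hmN,
    lintegral_biUnion_finset hpd hm, measure_biUnion_finset hpd hm,
    iidLaw_apply_eq_setLIntegral_exp hZ h hBN]
  congr 1
  · refine Finset.sum_congr rfl fun n hn => ?_
    have hn' : n ≤ N := Nat.lt_succ_iff.1 (Finset.mem_range.1 hn)
    rw [iidLaw_apply_eq_setLIntegral_exp hZ h (hB n hn')]
    refine setLIntegral_congr_fun (hm n hn) fun ω hω => ?_
    simp only [stoppedSum_of_eq hω.1 hn']
  · refine setLIntegral_congr_fun hmN fun ω hω => ?_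
    simp only [stoppedSum_of_le hω.1.le]

theorem tsum_measure_lt_eq_lintegral (P : Measure (ℕ → E)) {T : (ℕ → E) → ℕ∞}
    (hT : ∀ n : ℕ, MeasurableSet {ω | (n : ℕ∞) < T ω}) :
    ∑' k : ℕ, P {ω | (k : ℕ∞) < T ω} = ∫⁻ ω, (T ω : ℝ≥0∞) ∂P := by
  have h1 : ∀ ω, ((T ω : ℕ∞) : ℝ≥0∞) =
      ∑' k : ℕ, {ω | (k : ℕ∞) < T ω}.indicator (1 : (ℕ → E) → ℝ≥0∞) ω := by
    intro ω
    rcases eq_or_ne (T ω) ⊤ with h | h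
    · simp [h]
    · obtain ⟨n, hn⟩ := ENat.ne_top_iff_exists.1 h
      rw [tsum_eq_sum (s := Finset.range n)]
      · rw [Finset.sum_congr rfl (g := fun _ => 1), ← hn]
        · simp
        · intro k hk
          refine Set.indicator_of_mem ?_ _
          simp only [Set.mem_ofPred_eq, ← hn, Nat.cast_lt]
          exact Finset.mem_range.1 hk
      · intro k hk
        refine Set.indicator_of_notMem ?_ _
        simp only [Set.mem_ofPred_eq, ← hn, Nat.cast_lt]
        simpa using hk
  simp_rw [h1]
  rw [lintegral_tsum fun k => (measurable_one.indicator (hT k)).aemeasurable]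
  exact tsum_congr fun k => (lintegral_indicator_one (hT k)).symm

theorem sum_measureReal_lt_le_toReal (P : Measure (ℕ → E)) [IsFiniteMeasure P]
    {T : (ℕ → E) → ℕ∞} (hT : ∀ n : ℕ, MeasurableSet {ω | (n : ℕ∞) < T ω})
    (hfin : ∫⁻ ω, (T ω : ℝ≥0∞) ∂P ≠ ⊤) (N : ℕ) :
    ∑ k ∈ Finset.range N, P.real {ω | (k : ℕ∞) < T ω} ≤ (∫⁻ ω, (T ω : ℝ≥0∞) ∂P).toReal := by
  simp only [Measure.real]
  rw [← ENNReal.toReal_sum fun k _ => measure_ne_top _ _]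
  refine ENNReal.toReal_mono hfin ?_
  rw [← tsum_measure_lt_eq_lintegral P hT]
  exact ENNReal.sum_le_tsum _

/-- The tail-sum formula turns bounds on the mean of `T ∧ N`, uniform in `N`, into a bound on the
mean of `T`, without assuming finiteness beforehand. -/
theorem lintegral_le_of_sum_measureReal_lt_le (P : Measure (ℕ → E)) [IsFiniteMeasure P]
    {T : (ℕ → E) → ℕ∞} (hT : ∀ n : ℕ, MeasurableSet {ω | (n : ℕ∞) < T ω}) {c : ℝ}
    (h : ∀ N : ℕ, ∑ k ∈ Finset.range N, P.real {ω | (k : ℕ∞) < T ω} ≤ c) :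
    ∫⁻ ω, (T ω : ℝ≥0∞) ∂P ≤ ENNReal.ofReal c := by
  rw [← tsum_measure_lt_eq_lintegral P hT, ENNReal.tsum_eq_iSup_nat]
  refine iSup_le fun N => ?_
  rw [← ENNReal.ofReal_toReal (ENNReal.sum_ne_top.2 fun k _ => measure_ne_top P _),
    ENNReal.toReal_sum fun k _ => measure_ne_top _ _]
  exact ENNReal.ofReal_le_ofReal (h N)

/-- A random walk with positive drift `∫ Z` spends, on average, a time of at most
`(1 + ε) b / ∫ Z + C` below the level `b`. -/
theorem exists_lintegral_hitting_le (μ : Measure E) [IsProbabilityMeasure μ] {Z : E → ℝ}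
    (hZm : Measurable Z) (hZ : Integrable Z μ) (hI : 0 < ∫ x, Z x ∂μ) {ε : ℝ} (hε : 0 < ε) :
    ∃ C : ℝ, 0 ≤ C ∧ ∀ b : ℝ, 0 ≤ b → ∀ T : (ℕ → E) → ℕ∞,
      (∀ n : ℕ, MeasurableSet[obsSigma E n] {ω | (n : ℕ∞) < T ω}) →
      (∀ ω, ∀ k : ℕ, 1 ≤ k → (k : ℕ∞) < T ω → ∑ i ∈ Finset.range k, Z (ω i) < b) →
      ∫⁻ ω, (T ω : ℝ≥0∞) ∂iidLaw μ ≤ ENNReal.ofReal ((1 + ε) * b / (∫ x, Z x ∂μ) + C) := by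
  set I := ∫ x, Z x ∂μ with hIdef
  have hlim : Tendsto (fun c : ℕ => ∫ x, min (Z x) (c : ℝ) ∂μ) atTop (𝓝 I) := by
    refine tendsto_integral_of_dominated_convergence (fun x => |Z x|)
      (fun c => (hZm.min measurable_const).aestronglyMeasurable) hZ.abs
      (fun c => ae_of_all _ fun x => ?_) (ae_of_all _ fun x => ?_)
    · rw [Real.norm_eq_abs, abs_le]
      refine ⟨le_min (neg_abs_le _) ?_, (min_le_left _ _).trans (le_abs_self _)⟩
      exact (neg_nonpos.2 (abs_nonneg _)).trans (Nat.cast_nonneg c)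
    · refine tendsto_const_nhds.congr' ?_
      filter_upwards [eventually_ge_atTop ⌈Z x⌉₊] with c hc
      exact (min_eq_left ((Nat.le_ceil _).trans (by exact_mod_cast hc))).symm
  have hlt : I / (1 + ε) < I := div_lt_self hI (by linarith)
  -- Truncation at a high level `c` costs at most the factor `1 + ε` in the drift; the overshoot, at
  -- most `c`, then costs the additive constant `(1 + ε) c / I`, whatever `b` is.
  obtain ⟨c, hc⟩ := (hlim.eventually_const_lt hlt).exists
  have hpos : 0 < I / (1 + ε) := by positivity
  refine ⟨(1 + ε) * c / I, by positivity, fun b hb T hT hTb => ?_⟩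
  have hTm : ∀ n : ℕ, MeasurableSet {ω | (n : ℕ∞) < T ω} := fun n => obsSigma_le n _ (hT n)
  refine lintegral_le_of_sum_measureReal_lt_le _ hTm fun N => ?_
  have hint : Integrable (fun x => min (Z x) (c : ℝ)) μ := hZ.inf (integrable_const _)
  have h1 := integral_stoppedSum μ hT (hZm.min measurable_const) hint N
  have h2 : ∫ ω, stoppedSum T (fun x => min (Z x) (c : ℝ)) N ω ∂iidLaw μ ≤ b + c := by
    refine (integral_mono (integrable_stoppedSum μ hT hint N) (integrable_const (b + (c : ℝ)))
      fun ω => stoppedSum_min_le hb (Nat.cast_nonneg c) hTb N ω).trans ?_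
    simp
  rw [h1] at h2
  have h0 : 0 ≤ ∑ k ∈ Finset.range N, (iidLaw μ).real {ω | (k : ℕ∞) < T ω} :=
    Finset.sum_nonneg fun _ _ => measureReal_nonneg
  have h3 := (mul_le_mul_of_nonneg_left hc.le h0).trans h2
  have h4 : (∑ k ∈ Finset.range N, (iidLaw μ).real {ω | (k : ℕ∞) < T ω}) ≤
      (b + c) / (I / (1 + ε)) := (le_div_iff₀ hpos).2 h3
  refine h4.trans (le_of_eq ?_)
  field_simp

end StoppedSum

/-! ### Lower bound on the expected sample size, and error bounds -/

section SequentialTests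

variable {E : Type*} [MeasurableSpace E]

theorem SeqTest.measurableSet_lt_T (χ : SeqTest E) (n : ℕ) :
    MeasurableSet[obsSigma E n] {ω | (n : ℕ∞) < χ.T ω} := by
  have h : {ω | (n : ℕ∞) < χ.T ω} = ⋂ k ∈ Finset.Icc 1 n, {ω | χ.T ω = (k : ℕ)}ᶜ := by
    ext ω
    simp only [Set.mem_ofPred_eq, Set.mem_iInter, Finset.mem_Icc, Set.mem_compl_iff]
    constructor
    · rintro h k ⟨-, hk⟩ hT
      rw [hT, Nat.cast_lt] at h
      omega
    · intro h
      by_contra hlt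
      rw [not_lt] at hlt
      obtain ⟨k, hk⟩ := ENat.ne_top_iff_exists.1 (ne_top_of_le_ne_top (ENat.natCast_ne_top n) hlt)
      have h1 := χ.one_le_T ω
      rw [← hk] at hlt h1
      exact h k ⟨by exact_mod_cast h1, by exact_mod_cast hlt⟩ hk.symm
  rw [h]
  refine Finset.measurableSet_biInter _ fun k hk => ?_
  obtain ⟨h1, h2⟩ := Finset.mem_Icc.1 hk
  exact (obsSigma_mono h2 _ (χ.measurableSet_T k h1)).compl

/-- Both the event of an early decision `i` and its complement are determined by time `T ∧ N`. The
information inequality integrates over each of them. -/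
theorem SeqTest.setLIntegral_exp_neg_stoppedSum (χ : SeqTest E) {μ₀ μ₁ : Measure E}
    [IsProbabilityMeasure μ₀] [IsProbabilityMeasure μ₁] {Z : E → ℝ} (hZ : Measurable Z)
    (h : μ₁ = μ₀.withDensity fun x => ENNReal.ofReal (Real.exp (-Z x))) (N : ℕ) (i : Bool) :
    ∫⁻ ω in {ω | χ.T ω ≤ N ∧ χ.D ω = i}, ENNReal.ofReal (Real.exp (-stoppedSum χ.T Z N ω))
        ∂iidLaw μ₀ = iidLaw μ₁ {ω | χ.T ω ≤ N ∧ χ.D ω = i} ∧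
    ∫⁻ ω in {ω | χ.T ω ≤ N ∧ χ.D ω = i}ᶜ, ENNReal.ofReal (Real.exp (-stoppedSum χ.T Z N ω))
        ∂iidLaw μ₀ = iidLaw μ₁ {ω | χ.T ω ≤ N ∧ χ.D ω = i}ᶜ := by
  have hzero : ∀ ω, χ.T ω ≠ ((0 : ℕ) : ℕ∞) := fun ω h0 => by
    have := χ.one_le_T ω
    rw [h0] at this
    simp at this
  have key : ∀ n ≤ N, ∀ B : Set (ℕ → E), ∀ j : Bool,
      (∀ ω, χ.T ω = n → (ω ∈ B ↔ χ.D ω = j)) →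
      MeasurableSet[obsSigma E n] {ω | χ.T ω = n ∧ ω ∈ B} := by
    intro n _ B j hB
    rcases Nat.eq_zero_or_pos n with rfl | hn
    · have : {ω | χ.T ω = ((0 : ℕ) : ℕ∞) ∧ ω ∈ B} = ∅ :=
        Set.eq_empty_iff_forall_notMem.2 fun ω hω => hzero ω hω.1
      rw [this]
      exact @MeasurableSet.empty _ (obsSigma E 0)
    · have : {ω | χ.T ω = n ∧ ω ∈ B} = {ω | χ.T ω = n ∧ χ.D ω = j} :=
        Set.ext fun ω => and_congr_right (hB ω)
      rw [this]
      exact χ.measurableSet_T_D n hn j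
  constructor
  · refine _root_.setLIntegral_exp_neg_stoppedSum hZ h (fun n hn => key n hn _ i ?_) ?_
    · intro ω hT
      simp [hT, hn]
    · have : {ω | (N : ℕ∞) < χ.T ω ∧ ω ∈ {ω | χ.T ω ≤ N ∧ χ.D ω = i}} = ∅ :=
        Set.eq_empty_iff_forall_notMem.2 fun ω hω => hω.1.not_ge hω.2.1
      rw [this]
      exact @MeasurableSet.empty _ (obsSigma E N)
  · refine _root_.setLIntegral_exp_neg_stoppedSum hZ h (fun n hn => key n hn _ (!i) ?_) ?_
    · intro ω hT
      cases i <;> simp [hT, hn]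
    · have : {ω | (N : ℕ∞) < χ.T ω ∧ ω ∈ {ω | χ.T ω ≤ N ∧ χ.D ω = i}ᶜ} =
          {ω | (N : ℕ∞) < χ.T ω} := by
        ext ω
        simp only [Set.mem_ofPred_eq, Set.mem_compl_iff, and_iff_left_iff_imp]
        exact fun h1 h2 => h1.not_ge h2.1
      rw [this]
      exact χ.measurableSet_lt_T N

theorem SeqTest.measurableSet_T_le (χ : SeqTest E) (N : ℕ) (i : Bool) :
    MeasurableSet {ω | χ.T ω ≤ N ∧ χ.D ω = i} := by
  have h : {ω | χ.T ω ≤ N ∧ χ.D ω = i} = {ω | (N : ℕ∞) < χ.T ω}ᶜ ∩ χ.D ⁻¹' {i} := by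
    ext ω; simp
  rw [h]
  exact (obsSigma_le N _ (χ.measurableSet_lt_T N)).compl.inter
    (χ.measurable_D (measurableSet_singleton i))

/-- The information inequality for the time `T ∧ N`. -/
theorem SeqTest.log_mul_measure_le (χ : SeqTest E) {μ₀ μ₁ : Measure E}
    [IsProbabilityMeasure μ₀] [IsProbabilityMeasure μ₁] {Z : E → ℝ} (hZm : Measurable Z)
    (hZ : Integrable Z μ₀)
    (h : μ₁ = μ₀.withDensity fun x => ENNReal.ofReal (Real.exp (-Z x))) {β : ℝ} (hβ : 0 < β)
    {i : Bool} (hi : iidLaw μ₁ {ω | χ.D ω = i} ≤ ENNReal.ofReal β) (N : ℕ) :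
    Real.log (1 / β) * (iidLaw μ₀).real {ω | χ.T ω ≤ N ∧ χ.D ω = i} - 1 ≤
      (∑ k ∈ Finset.range N, (iidLaw μ₀).real {ω | (k : ℕ∞) < χ.T ω}) * ∫ x, Z x ∂μ₀ := by
  set B := {ω | χ.T ω ≤ N ∧ χ.D ω = i} with hBdef
  have hB : MeasurableSet B := χ.measurableSet_T_le N i
  obtain ⟨hc1, hc2⟩ := χ.setLIntegral_exp_neg_stoppedSum hZm h N i
  set X := stoppedSum χ.T Z N with hX
  have hXm : Measurable X := measurable_stoppedSum χ.measurableSet_lt_T hZm N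
  have hXi : Integrable X (iidLaw μ₀) := integrable_stoppedSum μ₀ χ.measurableSet_lt_T hZ N
  set G : (ℕ → E) → ℝ := B.indicator fun _ => Real.log (1 / β) with hG
  have hGm : Measurable G := measurable_const.indicator hB
  have hGi : Integrable G (iidLaw μ₀) := (integrable_const _).indicator hB
  -- The bonus `log (1 / β)` on `B` is the largest that keeps the contribution of `B` at most `1`,
  -- since `P₁ B ≤ β`; the complement contributes `P₁ Bᶜ ≤ 1`.
  have hlin : ∫⁻ ω, ENNReal.ofReal (Real.exp (G ω - X ω)) ∂iidLaw μ₀ ≤ 2 := by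
    rw [← lintegral_add_compl _ hB]
    have e1 : ∫⁻ ω in B, ENNReal.ofReal (Real.exp (G ω - X ω)) ∂iidLaw μ₀ ≤ 1 := by
      have : ∫⁻ ω in B, ENNReal.ofReal (Real.exp (G ω - X ω)) ∂iidLaw μ₀ =
          ∫⁻ ω in B, ENNReal.ofReal (1 / β) * ENNReal.ofReal (Real.exp (-X ω)) ∂iidLaw μ₀ := by
        refine setLIntegral_congr_fun hB fun ω hω => ?_
        simp only [hG, Set.indicator_of_mem hω]
        rw [← ENNReal.ofReal_mul (by positivity), sub_eq_add_neg, Real.exp_add,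
          Real.exp_log (by positivity)]
      rw [this, lintegral_const_mul _ (by fun_prop), hc1]
      calc ENNReal.ofReal (1 / β) * iidLaw μ₁ B
          ≤ ENNReal.ofReal (1 / β) * ENNReal.ofReal β := by
            gcongr
            exact (measure_mono fun ω hω => hω.2).trans hi
        _ = 1 := by
            rw [← ENNReal.ofReal_mul (by positivity), one_div_mul_cancel hβ.ne',
              ENNReal.ofReal_one]
    have e2 : ∫⁻ ω in Bᶜ, ENNReal.ofReal (Real.exp (G ω - X ω)) ∂iidLaw μ₀ ≤ 1 := by
      have : ∫⁻ ω in Bᶜ, ENNReal.ofReal (Real.exp (G ω - X ω)) ∂iidLaw μ₀ =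
          ∫⁻ ω in Bᶜ, ENNReal.ofReal (Real.exp (-X ω)) ∂iidLaw μ₀ := by
        refine setLIntegral_congr_fun hB.compl fun ω hω => ?_
        simp only [hG, Set.indicator_of_notMem hω, zero_sub]
      rw [this, hc2]
      exact prob_le_one
    calc _ ≤ (1 : ℝ≥0∞) + 1 := add_le_add e1 e2
      _ = 2 := one_add_one_eq_two
  have hem : Measurable fun ω => Real.exp (G ω - X ω) := by fun_prop
  have hei : Integrable (fun ω => Real.exp (G ω - X ω)) (iidLaw μ₀) := by
    refine ⟨hem.aestronglyMeasurable, ?_⟩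
    rw [hasFiniteIntegral_iff_ofReal (ae_of_all _ fun _ => (Real.exp_pos _).le)]
    exact hlin.trans_lt (by simp)
  have hexp : ∫ ω, Real.exp (G ω - X ω) ∂iidLaw μ₀ ≤ 2 := by
    rw [integral_eq_lintegral_of_nonneg_ae (ae_of_all _ fun _ => (Real.exp_pos _).le)
      hem.aestronglyMeasurable]
    exact ENNReal.toReal_le_of_le_ofReal (by norm_num) (by simpa using hlin)
  -- With the bound `2` on the right, `1 + x ≤ exp x` leaves `E₀[G] - 1 ≤ E₀[X]`, and Wald's
  -- identity evaluates `E₀[X]`.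
  have hmono : ∫ ω, (G ω - X ω + 1) ∂iidLaw μ₀ ≤ ∫ ω, Real.exp (G ω - X ω) ∂iidLaw μ₀ :=
    integral_mono ((hGi.sub hXi).add (integrable_const _)) hei fun ω => Real.add_one_le_exp _
  have hGint : ∫ ω, G ω ∂iidLaw μ₀ = Real.log (1 / β) * (iidLaw μ₀).real B := by
    rw [hG, integral_indicator hB, setIntegral_const, smul_eq_mul, mul_comm]
  rw [integral_add (f := fun ω => G ω - X ω) (hGi.sub hXi) (integrable_const _),
    integral_sub hGi hXi, hGint, hX,
    integral_stoppedSum μ₀ χ.measurableSet_lt_T hZm hZ N] at hmono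
  simp only [integral_const, probReal_univ, smul_eq_mul, mul_one] at hmono
  linarith

/-- The lower bound on the expected sample size of a test. -/
theorem SeqTest.le_ess (χ : SeqTest E) {μ₀ μ₁ : Measure E}
    [IsProbabilityMeasure μ₀] [IsProbabilityMeasure μ₁] {Z : E → ℝ} (hZm : Measurable Z)
    (hZ : Integrable Z μ₀) (hI : 0 < ∫ x, Z x ∂μ₀)
    (h : μ₁ = μ₀.withDensity fun x => ENNReal.ofReal (Real.exp (-Z x))) {α β : ℝ} (hα : 0 ≤ α)
    (hβ : 0 < β) (hβ1 : β ≤ 1) {i : Bool}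
    (h0 : iidLaw μ₀ {ω | χ.D ω = !i} ≤ ENNReal.ofReal α)
    (h1 : iidLaw μ₁ {ω | χ.D ω = i} ≤ ENNReal.ofReal β) :
    ENNReal.ofReal (((1 - α) * Real.log (1 / β) - 1) / ∫ x, Z x ∂μ₀) ≤ χ.ess (iidLaw μ₀) := by
  set I := ∫ x, Z x ∂μ₀ with hIdef
  rcases eq_or_ne (χ.ess (iidLaw μ₀)) ⊤ with htop | hfin
  · rw [htop]; exact le_top
  have hTm : ∀ n : ℕ, MeasurableSet {ω | (n : ℕ∞) < χ.T ω} :=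
    fun n => obsSigma_le n _ (χ.measurableSet_lt_T n)
  set e := (χ.ess (iidLaw μ₀)).toReal with he
  have he0 : 0 ≤ e := ENNReal.toReal_nonneg
  have hsum : ∀ N : ℕ, ∑ k ∈ Finset.range N, (iidLaw μ₀).real {ω | (k : ℕ∞) < χ.T ω} ≤ e :=
    sum_measureReal_lt_le_toReal _ hTm hfin
  have htail : ∀ N : ℕ, 0 < N → (iidLaw μ₀).real {ω | (N : ℕ∞) < χ.T ω} ≤ e / N := by
    intro N hN
    rw [le_div_iff₀ (by exact_mod_cast hN)]
    refine le_trans ?_ (hsum N)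
    have : (iidLaw μ₀).real {ω | (N : ℕ∞) < χ.T ω} * N =
        ∑ k ∈ Finset.range N, (iidLaw μ₀).real {ω | (N : ℕ∞) < χ.T ω} := by
      simp [mul_comm]
    rw [this]
    refine Finset.sum_le_sum fun k hk => measureReal_mono fun ω hω => ?_
    exact lt_trans (b := (N : ℕ∞)) (by exact_mod_cast Finset.mem_range.1 hk) hω
  have hDm : MeasurableSet {ω | χ.D ω = !i} := χ.measurable_D (measurableSet_singleton (!i))
  have hα' : (iidLaw μ₀).real {ω | χ.D ω = !i} ≤ α :=
    ENNReal.toReal_le_of_le_ofReal hα h0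
  have hlog : 0 ≤ Real.log (1 / β) := Real.log_nonneg ((one_le_div hβ).2 hβ1)
  -- The decision `i` has been made by time `N` unless the decision is wrong or `T > N`, events of
  -- probability at most `α` and, by Markov's inequality, `e / N`. The second vanishes as `N` tends
  -- to infinity.
  have hmain : ∀ N : ℕ, 0 < N → Real.log (1 / β) * (1 - α - e / N) - 1 ≤ e * I := by
    intro N hN
    refine le_trans ?_ ((χ.log_mul_measure_le hZm hZ h hβ h1 N).trans
      (mul_le_mul_of_nonneg_right (hsum N) hI.le))
    refine sub_le_sub_right (mul_le_mul_of_nonneg_left ?_ hlog) _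
    have hcov : (Set.univ : Set (ℕ → E)) ⊆ {ω | χ.T ω ≤ N ∧ χ.D ω = i} ∪
        ({ω | χ.D ω = !i} ∪ {ω | (N : ℕ∞) < χ.T ω}) := by
      intro ω _
      rcases lt_or_ge (N : ℕ∞) (χ.T ω) with hlt | hge
      · exact Or.inr (Or.inr hlt)
      · by_cases hD : χ.D ω = i
        · exact Or.inl ⟨hge, hD⟩
        · exact Or.inr (Or.inl (Bool.eq_not_of_ne hD))
    have hu := (measureReal_mono (μ := iidLaw μ₀) hcov).trans
      ((measureReal_union_le _ _).trans (add_le_add le_rfl (measureReal_union_le _ _)))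
    rw [probReal_univ] at hu
    linarith [htail N hN]
  have hlim : Tendsto (fun N : ℕ => Real.log (1 / β) * (1 - α - e / N) - 1) atTop
      (𝓝 (Real.log (1 / β) * (1 - α - 0) - 1)) :=
    ((tendsto_const_nhds.sub (tendsto_const_div_atTop_nhds_zero_nat e)).const_mul _).sub_const 1
  have hle := le_of_tendsto hlim ((eventually_gt_atTop 0).mono hmain)
  refine ENNReal.ofReal_le_of_le_toReal ?_
  rw [div_le_iff₀ hI]
  linarith

/-- Wald's error bound: on `A n` the likelihood ratio `exp (-S n)` is at most `exp (-b)`, and the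
disjoint sets `A n` have total `P₀`-mass at most `1`. -/
theorem iidLaw_iUnion_le {μ₀ μ₁ : Measure E} [IsProbabilityMeasure μ₀]
    [IsProbabilityMeasure μ₁] {Z : E → ℝ} (hZ : Measurable Z)
    (h : μ₁ = μ₀.withDensity fun x => ENNReal.ofReal (Real.exp (-Z x))) {b : ℝ}
    {A : ℕ → Set (ℕ → E)} (hA : ∀ n, MeasurableSet[obsSigma E n] (A n))
    (hd : Pairwise (Function.onFun Disjoint A))
    (hb : ∀ n, ∀ ω ∈ A n, b ≤ ∑ i ∈ Finset.range n, Z (ω i)) :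
    iidLaw μ₁ (⋃ n, A n) ≤ ENNReal.ofReal (Real.exp (-b)) := by
  have hm : ∀ n, MeasurableSet (A n) := fun n => obsSigma_le n _ (hA n)
  calc iidLaw μ₁ (⋃ n, A n) ≤ ∑' n, iidLaw μ₁ (A n) := measure_iUnion_le A
    _ ≤ ∑' n, ENNReal.ofReal (Real.exp (-b)) * iidLaw μ₀ (A n) := by
        refine ENNReal.tsum_le_tsum fun n => ?_
        rw [iidLaw_apply_eq_setLIntegral_exp hZ h (hA n)]
        refine (setLIntegral_mono measurable_const fun ω hω => ?_).trans
          (setLIntegral_const (A n) (ENNReal.ofReal (Real.exp (-b)))).le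
        exact ENNReal.ofReal_le_ofReal (Real.exp_le_exp.2 (neg_le_neg (hb n ω hω)))
    _ = ENNReal.ofReal (Real.exp (-b)) * iidLaw μ₀ (⋃ n, A n) := by
        rw [ENNReal.tsum_mul_left, measure_iUnion hd hm]
    _ ≤ ENNReal.ofReal (Real.exp (-b)) := mul_le_of_le_one_right' prob_le_one

end SequentialTests

/-! ### First times with values in `ℕ∞` -/

section HittingTime

/-- The smallest natural number with the property `p`, or `⊤` if there is none. -/
noncomputable def firstTime (p : ℕ → Prop) : ℕ∞ := ⨅ (n : ℕ) (_ : p n), (n : ℕ∞)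

theorem natCast_le_firstTime_iff {p : ℕ → Prop} {n : ℕ} :
    (n : ℕ∞) ≤ firstTime p ↔ ∀ k < n, ¬ p k := by
  simp only [firstTime, le_iInf_iff, Nat.cast_le]
  exact ⟨fun h k hk hp => (h k hp).not_gt hk, fun h k hp => not_lt.1 fun hk => h k hk hp⟩

theorem natCast_lt_firstTime_iff {p : ℕ → Prop} {n : ℕ} :
    (n : ℕ∞) < firstTime p ↔ ∀ k ≤ n, ¬ p k := by
  rw [← ENat.add_one_le_iff (ENat.natCast_ne_top n)]
  have := natCast_le_firstTime_iff (p := p) (n := n + 1)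
  push_cast at this
  simp only [this, Nat.lt_succ_iff]

theorem firstTime_eq_natCast_iff {p : ℕ → Prop} {n : ℕ} :
    firstTime p = n ↔ p n ∧ ∀ k < n, ¬ p k := by
  constructor
  · intro h
    have h1 := natCast_le_firstTime_iff.1 h.ge
    refine ⟨?_, h1⟩
    by_contra hp
    have : (n : ℕ∞) < firstTime p := natCast_lt_firstTime_iff.2 fun k hk =>
      (lt_or_eq_of_le hk).elim (h1 k) fun e => e ▸ hp
    exact this.ne' h
  · rintro ⟨hp, h1⟩
    exact le_antisymm (iInf₂_le n hp) (natCast_le_firstTime_iff.2 h1)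

end HittingTime

/-! ### The sequential probability ratio test -/

section SPRT

variable {E : Type*} [MeasurableSpace E]

/-- The sequential probability ratio test stops at the first time at which the random walk
with steps `Z` is outside `(-a, b)`. -/
def sprtExit (Z : E → ℝ) (a b : ℝ) (ω : ℕ → E) (n : ℕ) : Prop :=
  1 ≤ n ∧ (b ≤ ∑ i ∈ Finset.range n, Z (ω i) ∨ ∑ i ∈ Finset.range n, Z (ω i) ≤ -a)

theorem measurableSet_sprtExit {Z : E → ℝ} (hZ : Measurable Z) (a b : ℝ) (n : ℕ) :
    MeasurableSet[obsSigma E n] {ω | sprtExit Z a b ω n} := by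
  have hS := measurable_obsSigma_sum hZ n
  by_cases hn : 1 ≤ n
  · have h : {ω | sprtExit Z a b ω n} =
        (fun ω : ℕ → E => ∑ i ∈ Finset.range n, Z (ω i)) ⁻¹' (Set.Ici b ∪ Set.Iic (-a)) := by
      ext ω
      simp [sprtExit, hn]
    rw [h]
    exact hS (measurableSet_Ici.union measurableSet_Iic)
  · have h : {ω | sprtExit Z a b ω n} = ∅ :=
      Set.eq_empty_iff_forall_notMem.2 fun ω hω => hn hω.1
    rw [h]
    exact @MeasurableSet.empty _ (obsSigma E n)

theorem measurableSet_firstTime_sprtExit {Z : E → ℝ} (hZ : Measurable Z) (a b : ℝ) (n : ℕ) :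
    MeasurableSet[obsSigma E n] {ω | firstTime (sprtExit Z a b ω) = n} := by
  have h : {ω | firstTime (sprtExit Z a b ω) = n} = {ω | sprtExit Z a b ω n} ∩
      ⋂ k ∈ Finset.range n, {ω | sprtExit Z a b ω k}ᶜ := by
    ext ω
    simp [firstTime_eq_natCast_iff]
  rw [h]
  refine (measurableSet_sprtExit hZ a b n).inter (Finset.measurableSet_biInter _ fun k hk => ?_)
  exact (obsSigma_mono (Finset.mem_range.1 hk).le _ (measurableSet_sprtExit hZ a b k)).compl

/-- The event that the sequential probability ratio test stops at time `n` at the lower boundary. -/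
def sprtRejectAt (Z : E → ℝ) (a b : ℝ) (n : ℕ) : Set (ℕ → E) :=
  {ω | firstTime (sprtExit Z a b ω) = n ∧ ∑ i ∈ Finset.range n, Z (ω i) ≤ -a}

theorem measurableSet_sprtRejectAt {Z : E → ℝ} (hZ : Measurable Z) (a b : ℝ) (n : ℕ) :
    MeasurableSet[obsSigma E n] (sprtRejectAt Z a b n) :=
  (measurableSet_firstTime_sprtExit hZ a b n).inter
    (measurable_obsSigma_sum hZ n measurableSet_Iic)

open Classical in
/-- The sequential probability ratio test, which rejects the null hypothesis when the random walk
with steps `Z` leaves `(-a, b)` at the lower boundary. -/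
noncomputable def sprt (Z : E → ℝ) (hZ : Measurable Z) (a b : ℝ) : SeqTest E where
  T ω := firstTime (sprtExit Z a b ω)
  D ω := decide (ω ∈ ⋃ n, sprtRejectAt Z a b n)
  one_le_T ω := by
    have := (natCast_le_firstTime_iff (p := sprtExit Z a b ω) (n := 1)).2
      fun k hk h => absurd h.1 (by omega)
    simpa using this
  measurable_D := by
    refine measurable_to_bool ?_
    have : (fun ω => decide (ω ∈ ⋃ n, sprtRejectAt Z a b n)) ⁻¹' {true} =
        ⋃ n, sprtRejectAt Z a b n := by
      ext ω; simp
    rw [this]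
    exact MeasurableSet.iUnion fun n => obsSigma_le n _ (measurableSet_sprtRejectAt hZ a b n)
  measurableSet_T n _ := measurableSet_firstTime_sprtExit hZ a b n
  measurableSet_T_D n _ i := by
    have hiff : ∀ ω, firstTime (sprtExit Z a b ω) = n →
        (ω ∈ ⋃ n, sprtRejectAt Z a b n ↔ ω ∈ sprtRejectAt Z a b n) := by
      intro ω hω
      refine ⟨fun h => ?_, fun h => Set.mem_iUnion.2 ⟨n, h⟩⟩
      obtain ⟨k, hk⟩ := Set.mem_iUnion.1 h
      have : k = n := by exact_mod_cast hk.1.symm.trans hω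
      exact this ▸ hk
    have hT := measurableSet_firstTime_sprtExit hZ a b n
    have hR := measurableSet_sprtRejectAt hZ a b n
    cases i
    · have : {ω | firstTime (sprtExit Z a b ω) = n ∧
          decide (ω ∈ ⋃ n, sprtRejectAt Z a b n) = false} =
          {ω | firstTime (sprtExit Z a b ω) = n} ∩ (sprtRejectAt Z a b n)ᶜ := by
        ext ω
        simp only [Set.mem_ofPred_eq, Set.mem_inter_iff, Set.mem_compl_iff, decide_eq_false_iff_not]
        exact and_congr_right fun h => not_congr (hiff ω h)
      rw [this]
      exact hT.inter hR.compl
    · have : {ω | firstTime (sprtExit Z a b ω) = n ∧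
          decide (ω ∈ ⋃ n, sprtRejectAt Z a b n) = true} =
          {ω | firstTime (sprtExit Z a b ω) = n} ∩ sprtRejectAt Z a b n := by
        ext ω
        simp only [Set.mem_ofPred_eq, Set.mem_inter_iff, decide_eq_true_eq]
        exact and_congr_right fun h => hiff ω h
      rw [this]
      exact hT.inter hR

theorem sprt_sum_mem {Z : E → ℝ} {hZ : Measurable Z} {a b : ℝ} {ω : ℕ → E} {k : ℕ} (hk : 1 ≤ k)
    (h : (k : ℕ∞) < (sprt Z hZ a b).T ω) :
    ∑ i ∈ Finset.range k, Z (ω i) ∈ Set.Ioo (-a) b := by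
  have h1 := natCast_lt_firstTime_iff.1 h k le_rfl
  simp only [sprtExit, hk, true_and, not_or, not_le] at h1
  exact ⟨h1.2, h1.1⟩

/-- The sequential probability ratio test with boundaries `-log (1 / α)` and `log (1 / β)` has
error probabilities at most `α` and `β`. -/
theorem sprt_mem_testClass {μ₀ μ₁ : Measure E} [IsProbabilityMeasure μ₀]
    [IsProbabilityMeasure μ₁] {Z : E → ℝ} (hZ : Measurable Z)
    (h₁ : μ₁ = μ₀.withDensity fun x => ENNReal.ofReal (Real.exp (-Z x)))
    (h₀ : μ₀ = μ₁.withDensity fun x => ENNReal.ofReal (Real.exp (Z x)))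
    {α β : ℝ} (hα : 0 < α) (hβ : 0 < β)
    (hT : (sprt Z hZ (Real.log (1 / α)) (Real.log (1 / β))).ess (iidLaw μ₁) ≠ ⊤) :
    sprt Z hZ (Real.log (1 / α)) (Real.log (1 / β)) ∈ testClass μ₀ μ₁ α β := by
  set a := Real.log (1 / α) with ha
  set b := Real.log (1 / β) with hb
  have hexp : ∀ x : ℝ, 0 < x → Real.exp (-Real.log (1 / x)) = x := fun x hx => by
    rw [Real.exp_neg, Real.exp_log (by positivity), one_div, inv_inv]
  have hdisj : Pairwise (Function.onFun Disjoint
      fun n : ℕ => {ω | firstTime (sprtExit Z a b ω) = n}) := by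
    intro i j hij
    refine Set.disjoint_left.2 fun ω h1 h2 => hij ?_
    exact_mod_cast Eq.trans (Eq.symm h1) h2
  constructor
  · have hset : {ω | (sprt Z hZ a b).D ω = true} = ⋃ n, sprtRejectAt Z a b n := by
      ext ω; simp [sprt]
    rw [hset, ← hexp α hα]
    -- The same error bound with the hypotheses exchanged and the walk reversed.
    refine iidLaw_iUnion_le (μ₀ := μ₁) (Z := fun x => -Z x) hZ.neg (by simpa using h₀)
      (fun n => measurableSet_sprtRejectAt hZ a b n)
      (fun i j hij => (hdisj hij).mono (fun ω h => h.1) fun ω h => h.1) fun n ω hω => ?_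
    rw [Finset.sum_neg_distrib]
    exact le_neg.2 hω.2
  -- A test that never stops has `D = false` by default. This is harmless for type-I errors but
  -- counts as a type-II error, so `T = ⊤` must be `P₁`-null; finiteness of `E₁[T]` gives that.
  · have hset : {ω | (sprt Z hZ a b).D ω = false} ⊆
        (⋃ n : ℕ, {ω | firstTime (sprtExit Z a b ω) = n ∧ b ≤ ∑ i ∈ Finset.range n, Z (ω i)}) ∪
          {ω | (((sprt Z hZ a b).T ω : ℕ∞) : ℝ≥0∞) = ⊤} := by
      intro ω hω
      rcases eq_or_ne ((sprt Z hZ a b).T ω) ⊤ with h | h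
      · right
        simp [h]
      · left
        obtain ⟨n, hn⟩ := ENat.ne_top_iff_exists.1 h
        have hn' : firstTime (sprtExit Z a b ω) = n := hn.symm
        refine Set.mem_iUnion.2 ⟨n, hn', ?_⟩
        refine (firstTime_eq_natCast_iff.1 hn').1.2.resolve_right fun hle => ?_
        have hmem : ω ∈ ⋃ n, sprtRejectAt Z a b n := Set.mem_iUnion.2 ⟨n, hn', hle⟩
        have : (sprt Z hZ a b).D ω = true := by simpa [sprt] using hmem
        rw [hω] at this
        exact Bool.false_ne_true this
    have hTm : ∀ n : ℕ, MeasurableSet {ω | (n : ℕ∞) < (sprt Z hZ a b).T ω} :=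
      fun n => obsSigma_le n _ ((sprt Z hZ a b).measurableSet_lt_T n)
    have htop : iidLaw μ₁ {ω | (((sprt Z hZ a b).T ω : ℕ∞) : ℝ≥0∞) = ⊤} = 0 := by
      have h0 : Tendsto (fun n : ℕ => iidLaw μ₁ {ω | (n : ℕ∞) < (sprt Z hZ a b).T ω}) atTop
          (𝓝 0) := by
        refine ENNReal.tendsto_atTop_zero_of_tsum_ne_top ?_
        rw [tsum_measure_lt_eq_lintegral _ hTm]
        exact hT
      refine le_antisymm (ge_of_tendsto h0 (Eventually.of_forall fun n => measure_mono ?_))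
        zero_le
      intro ω hω
      have : (sprt Z hZ a b).T ω = ⊤ := by simpa using hω
      simp [this]
    refine (measure_mono hset).trans ((measure_union_le _ _).trans ?_)
    rw [htop, add_zero, ← hexp β hβ]
    refine iidLaw_iUnion_le hZ h₁ (fun n => ?_)
      (fun i j hij => (hdisj hij).mono (fun ω h => h.1) fun ω h => h.1) fun n ω hω => hω.2
    exact (measurableSet_firstTime_sprtExit hZ a b n).inter
      (measurable_obsSigma_sum hZ n measurableSet_Ici)

/-- For every `ε > 0`, the expected sample sizes of the sequential probability ratio test are, up
to an additive constant and a factor `1 + ε`, at most `log (1 / β) / I₀` and `log (1 / α) / I₁`. -/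
theorem exists_mem_testClass_ess_le {μ₀ μ₁ : Measure E} [IsProbabilityMeasure μ₀]
    [IsProbabilityMeasure μ₁] {Z : E → ℝ} (hZm : Measurable Z)
    (h₁ : μ₁ = μ₀.withDensity fun x => ENNReal.ofReal (Real.exp (-Z x)))
    (h₀ : μ₀ = μ₁.withDensity fun x => ENNReal.ofReal (Real.exp (Z x)))
    (hZ₀ : Integrable Z μ₀) (hZ₁ : Integrable Z μ₁) {I₀ I₁ : ℝ} (hI₀ : 0 < I₀) (hI₁ : 0 < I₁)
    (hint₀ : ∫ x, Z x ∂μ₀ = I₀) (hint₁ : ∫ x, -Z x ∂μ₁ = I₁) {ε : ℝ} (hε : 0 < ε) :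
    ∃ C : ℝ, ∀ α ∈ Set.Ioo (0 : ℝ) 1, ∀ β ∈ Set.Ioo (0 : ℝ) 1, ∃ χ ∈ testClass μ₀ μ₁ α β,
      χ.ess (iidLaw μ₀) ≤ ENNReal.ofReal ((1 + ε) * Real.log (1 / β) / I₀ + C) ∧
      χ.ess (iidLaw μ₁) ≤ ENNReal.ofReal ((1 + ε) * Real.log (1 / α) / I₁ + C) := by
  obtain ⟨C₀, hC₀, H₀⟩ := exists_lintegral_hitting_le μ₀ hZm hZ₀ (hint₀ ▸ hI₀) hε
  obtain ⟨C₁, hC₁, H₁⟩ := exists_lintegral_hitting_le μ₁ (Z := fun x => -Z x) hZm.neg hZ₁.neg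
    (hint₁ ▸ hI₁) hε
  rw [hint₀] at H₀
  rw [hint₁] at H₁
  refine ⟨max C₀ C₁, fun α hα β hβ => ?_⟩
  have ha : 0 ≤ Real.log (1 / α) := Real.log_nonneg ((one_le_div hα.1).2 hα.2.le)
  have hb : 0 ≤ Real.log (1 / β) := Real.log_nonneg ((one_le_div hβ.1).2 hβ.2.le)
  set χ := sprt Z hZm (Real.log (1 / α)) (Real.log (1 / β)) with hχ
  have e₀ := H₀ _ hb χ.T χ.measurableSet_lt_T fun ω k hk h => (sprt_sum_mem hk h).2
  have e₁ := H₁ _ ha χ.T χ.measurableSet_lt_T fun ω k hk h => by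
    rw [Finset.sum_neg_distrib]
    exact neg_lt.1 (sprt_sum_mem hk h).1
  refine ⟨χ, ?_, e₀.trans (ENNReal.ofReal_le_ofReal ?_), e₁.trans (ENNReal.ofReal_le_ofReal ?_)⟩
  · exact sprt_mem_testClass hZm h₁ h₀ hα.1 hβ.1 (e₁.trans_lt ENNReal.ofReal_lt_top).ne
  · gcongr; exact le_max_left _ _
  · gcongr; exact le_max_right _ _

end SPRT

/-! ### Binomial tails and the size of the individual levels -/

section BinomialLevels

theorem sum_binomial_eq_one (n : ℕ) (p : ℝ) :
    ∑ j ∈ Finset.range (n + 1), (n.choose j : ℝ) * p ^ j * (1 - p) ^ (n - j) = 1 := by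
  have h := congrArg (Polynomial.eval p) (bernsteinPolynomial.sum ℝ n)
  simpa [Polynomial.eval_finsetSum, bernsteinPolynomial] using h

theorem sum_mul_binomial_eq (n : ℕ) (p : ℝ) :
    ∑ j ∈ Finset.range (n + 1), (j : ℝ) * ((n.choose j : ℝ) * p ^ j * (1 - p) ^ (n - j)) =
      n * p := by
  have h := congrArg (Polynomial.eval p) (bernsteinPolynomial.sum_smul ℝ n)
  simpa [Polynomial.eval_finsetSum, bernsteinPolynomial] using h

theorem sum_sq_sub_mul_binomial_eq (n : ℕ) (p : ℝ) :
    ∑ j ∈ Finset.range (n + 1),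
      (n * p - j) ^ 2 * ((n.choose j : ℝ) * p ^ j * (1 - p) ^ (n - j)) = n * p * (1 - p) := by
  have h := congrArg (Polynomial.eval p) (bernsteinPolynomial.variance ℝ n)
  simpa [Polynomial.eval_finsetSum, bernsteinPolynomial] using h

theorem binomial_nonneg (n j : ℕ) {p : ℝ} (hp : p ∈ Set.Icc (0 : ℝ) 1) :
    0 ≤ (n.choose j : ℝ) * p ^ j * (1 - p) ^ (n - j) := by
  have := sub_nonneg.2 hp.2
  have := hp.1
  positivity

/-- Markov's inequality for the binomial distribution. -/
theorem mul_binomTail_le {n k : ℕ} {p : ℝ} (hp : p ∈ Set.Icc (0 : ℝ) 1) :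
    k * binomTail n p k ≤ n * p := by
  rw [← sum_mul_binomial_eq n p, binomTail, Finset.mul_sum]
  refine (Finset.sum_le_sum (g := fun j : ℕ =>
    (j : ℝ) * ((n.choose j : ℝ) * p ^ j * (1 - p) ^ (n - j))) fun j hj => ?_).trans
    (Finset.sum_le_sum_of_subset_of_nonneg (fun j hj => ?_) fun j _ _ => ?_)
  · refine mul_le_mul_of_nonneg_right ?_ (binomial_nonneg n j hp)
    exact_mod_cast (Finset.mem_Icc.1 hj).1
  · exact Finset.mem_range.2 (Nat.lt_succ_of_le (Finset.mem_Icc.1 hj).2)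
  · exact mul_nonneg (Nat.cast_nonneg j) (binomial_nonneg n j hp)

/-- Chebyshev's inequality for the lower tail of the binomial distribution. -/
theorem sq_mul_one_sub_binomTail_le {n k : ℕ} {p : ℝ} (hp : p ∈ Set.Icc (0 : ℝ) 1)
    (hkn : k ≤ n) (hk : (k : ℝ) ≤ n * p) :
    (n * p - k) ^ 2 * (1 - binomTail n p k) ≤ n * p := by
  have hsplit : 1 - binomTail n p k =
      ∑ j ∈ Finset.range k, (n.choose j : ℝ) * p ^ j * (1 - p) ^ (n - j) := by
    have h : Finset.Icc k n = Finset.Ico k (n + 1) := by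
      ext j; simp
    have e := sum_binomial_eq_one n p
    rw [← Finset.sum_range_add_sum_Ico _ (show k ≤ n + 1 by omega)] at e
    rw [binomTail, h]
    exact (eq_sub_of_add_eq e).symm
  have hvar : n * p * (1 - p) ≤ n * p :=
    mul_le_of_le_one_right (mul_nonneg (Nat.cast_nonneg n) hp.1) (by linarith [hp.1])
  refine le_trans ?_ hvar
  rw [hsplit, ← sum_sq_sub_mul_binomial_eq, Finset.mul_sum]
  refine (Finset.sum_le_sum (g := fun j : ℕ =>
    (n * p - j) ^ 2 * ((n.choose j : ℝ) * p ^ j * (1 - p) ^ (n - j))) fun j hj => ?_).trans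
    (Finset.sum_le_sum_of_subset_of_nonneg (Finset.range_mono (by omega)) fun j _ _ => ?_)
  · refine mul_le_mul_of_nonneg_right ?_ (binomial_nonneg n j hp)
    have : (j : ℝ) ≤ k := by exact_mod_cast (Finset.mem_range.1 hj).le
    exact pow_le_pow_left₀ (by linarith) (by linarith) 2
  · exact mul_nonneg (sq_nonneg _) (binomial_nonneg n j hp)

/-- By Markov's inequality the level `α k / n` is admissible. -/
theorem le_binomLevel {n k : ℕ} {α : ℝ} (hk : 1 ≤ k) (hkn : k ≤ n)
    (hα : α ∈ Set.Ioo (0 : ℝ) 1) : α * (k / n) ≤ binomLevel n k α := by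
  have hk0 : (0 : ℝ) < k := by exact_mod_cast hk
  have hn0 : (0 : ℝ) < n := hk0.trans_le (by exact_mod_cast hkn)
  have h1 : (k : ℝ) / n ≤ 1 := (div_le_one hn0).2 (by exact_mod_cast hkn)
  have h0 : 0 < (k : ℝ) / n := by positivity
  have hp : α * (k / n) ∈ Set.Ioo (0 : ℝ) 1 :=
    ⟨mul_pos hα.1 h0, (mul_le_of_le_one_right hα.1.le h1).trans_lt hα.2⟩
  refine (isGreatest_binomLevel n k α hk hkn hα).2 ⟨hp, ?_⟩
  have h := mul_binomTail_le (n := n) (k := k) ⟨hp.1.le, hp.2.le⟩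
  have e : (n : ℝ) * (α * (k / n)) = k * α := by field_simp
  rw [e] at h
  exact le_of_mul_le_mul_left h hk0

/-- For `n p` far above `k`, Chebyshev's inequality makes fewer than `k` successes unlikely, whereas
admissibility and `α < 1 / 2` give that event probability above `1 / 2`. -/
theorem binomLevel_le {n k : ℕ} {α : ℝ} (hk : 1 ≤ k) (hkn : k ≤ n)
    (hα : α ∈ Set.Ioo (0 : ℝ) (1 / 2)) : binomLevel n k α ≤ 4 * (k / n) := by
  obtain ⟨⟨hp0, hp1⟩, hp⟩ :=
    (isGreatest_binomLevel n k α hk hkn ⟨hα.1, hα.2.trans (by norm_num)⟩).1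
  set p := binomLevel n k α
  have hk1 : (1 : ℝ) ≤ k := by exact_mod_cast hk
  have hn0 : (0 : ℝ) < n := lt_of_lt_of_le (by linarith) (show (k : ℝ) ≤ n by exact_mod_cast hkn)
  by_contra hlt
  rw [not_le] at hlt
  have h4 : 4 * (k : ℝ) < n * p := by
    calc 4 * (k : ℝ) = n * (4 * (k / n)) := by field_simp
      _ < n * p := mul_lt_mul_of_pos_left hlt hn0
  have hc := sq_mul_one_sub_binomTail_le (n := n) (k := k) ⟨hp0.le, hp1.le⟩ hkn (by linarith)
  have hhalf : (1 : ℝ) / 2 ≤ 1 - binomTail n p k := by linarith [hα.2]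
  have h5 : (n * p - k) ^ 2 * (1 / 2) ≤ n * p :=
    (mul_le_mul_of_nonneg_left hhalf (sq_nonneg _)).trans hc
  -- From `n p > 4 k` one gets `n p - k > (3 / 4) n p`, so the previous bound gives `n p ≤ 32 / 9 <
  -- 4`, contradicting `n p > 4 k ≥ 4`.
  nlinarith

/-- The logarithm of the inverse of a level is asymptotically that of the ratio `n / k`. -/
theorem tendsto_log_binomLevel {n k : ℕ → ℕ} {α : ℝ} (hα : α ∈ Set.Ioo (0 : ℝ) (1 / 2))
    (hk : ∀ᶠ m in atTop, 1 ≤ k m ∧ k m < n m)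
    (hkn : Tendsto (fun m => (k m : ℝ) / n m) atTop (𝓝 0)) :
    (∀ᶠ m in atTop, binomLevel (n m) (k m) α ∈ Set.Ioo (0 : ℝ) 1) ∧
    Tendsto (fun m => binomLevel (n m) (k m) α) atTop (𝓝 0) ∧
    Tendsto (fun m => Real.log ((n m : ℝ) / k m)) atTop atTop ∧
    Tendsto (fun m => Real.log (1 / binomLevel (n m) (k m) α) / Real.log ((n m : ℝ) / k m)) atTop
      (𝓝 1) := by
  have hα' : α ∈ Set.Ioo (0 : ℝ) 1 := ⟨hα.1, hα.2.trans (by norm_num)⟩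
  have hIoo : ∀ᶠ m in atTop, binomLevel (n m) (k m) α ∈ Set.Ioo (0 : ℝ) 1 :=
    hk.mono fun m hm => (isGreatest_binomLevel _ _ α hm.1 hm.2.le hα').1.1
  have hratio : Tendsto (fun m => (n m : ℝ) / k m) atTop atTop := by
    have h1 : Tendsto (fun m => (k m : ℝ) / n m) atTop (𝓝[>] 0) := by
      refine tendsto_nhdsWithin_iff.2 ⟨hkn, hk.mono fun m hm => ?_⟩
      have h2 : (0 : ℝ) < k m := by exact_mod_cast hm.1
      have h3 : (0 : ℝ) < n m := by exact_mod_cast (lt_of_lt_of_le hm.1 hm.2.le)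
      exact div_pos h2 h3
    refine h1.inv_tendsto_nhdsGT_zero.congr fun m => ?_
    simp
  have hlog := Real.tendsto_log_atTop.comp hratio
  refine ⟨hIoo, ?_, hlog, ?_⟩
  · refine squeeze_zero' (hIoo.mono fun m hm => hm.1.le)
      (hk.mono fun m hm => binomLevel_le hm.1 hm.2.le hα) ?_
    simpa using hkn.const_mul 4
  -- The level lies within constant factors of `k / n`, so the logarithms differ by a bounded amount
  -- while `log (n / k)` diverges.
  · have hbd : ∀ᶠ m in atTop, |Real.log (1 / binomLevel (n m) (k m) α) -
        Real.log ((n m : ℝ) / k m)| ≤ max (Real.log 4) (Real.log (1 / α)) := by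
      filter_upwards [hk, hIoo] with m hm hp
      have hk0 : (0 : ℝ) < k m := by exact_mod_cast hm.1
      have hn0 : (0 : ℝ) < n m := by exact_mod_cast (lt_of_lt_of_le hm.1 hm.2.le)
      have hlo := le_binomLevel hm.1 hm.2.le hα'
      have hhi := binomLevel_le hm.1 hm.2.le hα
      set p := binomLevel (n m) (k m) α
      have hr : 0 < (k m : ℝ) / n m := by positivity
      have e1 := Real.log_le_log (mul_pos hα.1 hr) hlo
      have e2 := Real.log_le_log hp.1 hhi
      rw [Real.log_mul hα.1.ne' hr.ne'] at e1
      rw [Real.log_mul (by norm_num) hr.ne'] at e2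
      have e3 : Real.log ((n m : ℝ) / k m) = -Real.log ((k m : ℝ) / n m) := by
        rw [← Real.log_inv, inv_div]
      rw [one_div, one_div, Real.log_inv, Real.log_inv, e3, abs_le]
      constructor
      · linarith [le_max_left (Real.log 4) (-Real.log α)]
      · linarith [le_max_right (Real.log 4) (-Real.log α)]
    have hdiff : Tendsto (fun m => (Real.log (1 / binomLevel (n m) (k m) α) -
        Real.log ((n m : ℝ) / k m)) / Real.log ((n m : ℝ) / k m)) atTop (𝓝 0) :=
      tendsto_bdd_div_atTop_nhds_zero (hbd.mono fun m hm => (abs_le.1 hm).1)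
        (hbd.mono fun m hm => (abs_le.1 hm).2) hlog
    have h1 := hdiff.add_const 1
    rw [zero_add] at h1
    refine h1.congr' ?_
    filter_upwards [hlog.eventually_gt_atTop 0] with m hm
    have : Real.log ((n m : ℝ) / k m) ≠ 0 := ne_of_gt hm
    field_simp
    ring

end BinomialLevels

/-! ### From the two hypotheses to all mixtures -/

section AsymptoticOptimality

variable {E : Type*} [MeasurableSpace E]

theorem SeqTest.ess_mixLaw (χ : SeqTest E) (μ₀ μ₁ : Measure E) [IsProbabilityMeasure μ₀]
    [IsProbabilityMeasure μ₁] (π : ℝ) :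
    χ.ess (mixLaw μ₀ μ₁ π) = ENNReal.ofReal (1 - π) * χ.ess (iidLaw μ₀) +
      ENNReal.ofReal π * χ.ess (iidLaw μ₁) := by
  simp only [SeqTest.ess, mixLaw, lintegral_add_measure, lintegral_smul_measure, smul_eq_mul]

/-- Up to factors `1 - ε` and `1 + ε`, the numbers `x` and `y` are the smallest expected sample
sizes under the two hypotheses among the tests with error probabilities at most `α` and `β`, and
are attained by the same test. -/
def ESSBounds (μ₀ μ₁ : Measure E) [IsProbabilityMeasure μ₀] [IsProbabilityMeasure μ₁]
    (α β x y ε : ℝ) : Prop :=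
  (∀ χ ∈ testClass μ₀ μ₁ α β,
    ENNReal.ofReal (1 - ε) * ENNReal.ofReal x ≤ χ.ess (iidLaw μ₀) ∧
    ENNReal.ofReal (1 - ε) * ENNReal.ofReal y ≤ χ.ess (iidLaw μ₁)) ∧
  ∃ χ ∈ testClass μ₀ μ₁ α β,
    χ.ess (iidLaw μ₀) ≤ ENNReal.ofReal (1 + ε) * ENNReal.ofReal x ∧
    χ.ess (iidLaw μ₁) ≤ ENNReal.ofReal (1 + ε) * ENNReal.ofReal y

theorem eventually_mul_le_lower {α b B : ℕ → ℝ} (hα : Tendsto α atTop (𝓝 0))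
    (hB : Tendsto B atTop atTop) (hb : Tendsto (fun m => b m / B m) atTop (𝓝 1)) {ε : ℝ}
    (hε : 0 < ε) : ∀ᶠ m in atTop, (1 - ε) * B m ≤ (1 - α m) * b m - 1 := by
  have h1 : Tendsto (fun m => (1 - α m) * (b m / B m) - 1 / B m) atTop (𝓝 ((1 - 0) * 1 - 0)) :=
    ((tendsto_const_nhds.sub hα).mul hb).sub (hB.const_div_atTop 1)
  filter_upwards [h1.eventually_const_lt (show 1 - ε < (1 - 0) * 1 - 0 by linarith),
    hB.eventually_gt_atTop 0] with m hm hpos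
  have h2 := mul_le_mul_of_nonneg_right hm.le hpos.le
  refine h2.trans (le_of_eq ?_)
  field_simp

theorem eventually_upper_le_mul {b B : ℕ → ℝ} (hB : Tendsto B atTop atTop)
    (hb : Tendsto (fun m => b m / B m) atTop (𝓝 1)) {ε : ℝ} (hε : 0 < ε) (c : ℝ) :
    ∀ᶠ m in atTop, (1 + ε / 2) * b m + c ≤ (1 + ε) * B m := by
  have h1 : Tendsto (fun m => (1 + ε / 2) * (b m / B m) + c / B m) atTop
      (𝓝 ((1 + ε / 2) * 1 + 0)) :=
    (hb.const_mul _).add (hB.const_div_atTop c)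
  filter_upwards [h1.eventually_lt_const (show (1 + ε / 2) * 1 + 0 < 1 + ε by linarith),
    hB.eventually_gt_atTop 0] with m hm hpos
  have h2 := mul_le_mul_of_nonneg_right hm.le hpos.le
  refine le_trans (le_of_eq ?_) h2
  field_simp

theorem eventually_essBounds {μ₀ μ₁ : Measure E} [IsProbabilityMeasure μ₀]
    [IsProbabilityMeasure μ₁] {Z : E → ℝ} (hZm : Measurable Z)
    (h₁ : μ₁ = μ₀.withDensity fun x => ENNReal.ofReal (Real.exp (-Z x)))
    (h₀ : μ₀ = μ₁.withDensity fun x => ENNReal.ofReal (Real.exp (Z x)))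
    (hZ₀ : Integrable Z μ₀) (hZ₁ : Integrable Z μ₁) {I₀ I₁ : ℝ} (hI₀ : 0 < I₀) (hI₁ : 0 < I₁)
    (hint₀ : ∫ x, Z x ∂μ₀ = I₀) (hint₁ : ∫ x, -Z x ∂μ₁ = I₁) {α β A B : ℕ → ℝ}
    (hα : ∀ᶠ m in atTop, α m ∈ Set.Ioo (0 : ℝ) 1) (hβ : ∀ᶠ m in atTop, β m ∈ Set.Ioo (0 : ℝ) 1)
    (hα0 : Tendsto α atTop (𝓝 0)) (hβ0 : Tendsto β atTop (𝓝 0))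
    (hA : Tendsto A atTop atTop) (hB : Tendsto B atTop atTop)
    (hαA : Tendsto (fun m => Real.log (1 / α m) / A m) atTop (𝓝 1))
    (hβB : Tendsto (fun m => Real.log (1 / β m) / B m) atTop (𝓝 1)) {ε : ℝ} (hε : 0 < ε) :
    ∀ᶠ m in atTop, ESSBounds μ₀ μ₁ (α m) (β m) (B m / I₀) (A m / I₁) ε := by
  -- Half of `ε` pays for the truncation in the upper bound; the other half absorbs the additive
  -- constant, which becomes `C * I₀` or `C * I₁` over the common denominator.
  obtain ⟨C, hC⟩ := exists_mem_testClass_ess_le hZm h₁ h₀ hZ₀ hZ₁ hI₀ hI₁ hint₀ hint₁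
    (half_pos hε)
  filter_upwards [hα, hβ, hA.eventually_gt_atTop 0, hB.eventually_gt_atTop 0,
    eventually_mul_le_lower hα0 hB hβB hε, eventually_mul_le_lower hβ0 hA hαA hε,
    eventually_upper_le_mul hB hβB hε (C * I₀), eventually_upper_le_mul hA hαA hε (C * I₁)]
    with m hαm hβm hAm hBm hloB hloA hupB hupA
  have hx : 0 ≤ B m / I₀ := by positivity
  have hy : 0 ≤ A m / I₁ := by positivity
  constructor
  · intro χ hχ
    have e₀ := χ.le_ess (i := false) hZm hZ₀ (hint₀ ▸ hI₀) h₁ hαm.1.le hβm.1 hβm.2.le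
      hχ.1 hχ.2
    have e₁ := χ.le_ess (i := true) (Z := fun x => -Z x) hZm.neg hZ₁.neg (hint₁ ▸ hI₁)
      (by simpa using h₀) hβm.1.le hαm.1 hαm.2.le hχ.2 hχ.1
    rw [hint₀] at e₀
    rw [hint₁] at e₁
    rw [← ENNReal.ofReal_mul' hx, ← ENNReal.ofReal_mul' hy]
    constructor
    · refine le_trans (ENNReal.ofReal_le_ofReal ?_) e₀
      rw [← mul_div_assoc]
      gcongr
    · refine le_trans (ENNReal.ofReal_le_ofReal ?_) e₁
      rw [← mul_div_assoc]
      gcongr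
  · obtain ⟨χ, hχ, e₀, e₁⟩ := hC (α m) hαm (β m) hβm
    refine ⟨χ, hχ, ?_, ?_⟩
    · rw [← ENNReal.ofReal_mul' hx]
      refine e₀.trans (ENNReal.ofReal_le_ofReal ?_)
      rw [← mul_div_assoc, div_add' _ _ _ hI₀.ne']
      gcongr
    · rw [← ENNReal.ofReal_mul' hy]
      refine e₁.trans (ENNReal.ofReal_le_ofReal ?_)
      rw [← mul_div_assoc, div_add' _ _ _ hI₁.ne']
      gcongr

section ESSBounds

variable {μ₀ μ₁ : Measure E} [IsProbabilityMeasure μ₀] [IsProbabilityMeasure μ₁]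
  {α β x y ε : ℝ}

theorem ofReal_convexCombination {π : ℝ} (hπ : π ∈ Set.Icc (0 : ℝ) 1) (hx : 0 ≤ x)
    (hy : 0 ≤ y) : ENNReal.ofReal ((1 - π) * x + π * y) =
      ENNReal.ofReal (1 - π) * ENNReal.ofReal x + ENNReal.ofReal π * ENNReal.ofReal y := by
  have := sub_nonneg.2 hπ.2
  rw [ENNReal.ofReal_add (mul_nonneg this hx) (mul_nonneg hπ.1 hy), ENNReal.ofReal_mul this,
    ENNReal.ofReal_mul hπ.1]

theorem ESSBounds.le_ess_mixLaw (h : ESSBounds μ₀ μ₁ α β x y ε) {π : ℝ}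
    (hπ : π ∈ Set.Icc (0 : ℝ) 1) (hx : 0 ≤ x) (hy : 0 ≤ y) {χ : SeqTest E}
    (hχ : χ ∈ testClass μ₀ μ₁ α β) :
    ENNReal.ofReal (1 - ε) * ENNReal.ofReal ((1 - π) * x + π * y) ≤ χ.ess (mixLaw μ₀ μ₁ π) := by
  obtain ⟨e₀, e₁⟩ := h.1 χ hχ
  rw [ofReal_convexCombination hπ hx hy, χ.ess_mixLaw, mul_add, mul_left_comm,
    mul_left_comm (ENNReal.ofReal (1 - ε)) (ENNReal.ofReal π)]
  gcongr

theorem ESSBounds.le_optESS_mixLaw (h : ESSBounds μ₀ μ₁ α β x y ε) {π : ℝ}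
    (hπ : π ∈ Set.Icc (0 : ℝ) 1) (hx : 0 ≤ x) (hy : 0 ≤ y) :
    ENNReal.ofReal (1 - ε) * ENNReal.ofReal ((1 - π) * x + π * y) ≤
      optESS μ₀ μ₁ (mixLaw μ₀ μ₁ π) α β :=
  le_iInf₂ fun _ hχ => h.le_ess_mixLaw hπ hx hy hχ

theorem ESSBounds.optESS_mixLaw_le (h : ESSBounds μ₀ μ₁ α β x y ε) {π : ℝ}
    (hπ : π ∈ Set.Icc (0 : ℝ) 1) (hx : 0 ≤ x) (hy : 0 ≤ y) :
    optESS μ₀ μ₁ (mixLaw μ₀ μ₁ π) α β ≤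
      ENNReal.ofReal (1 + ε) * ENNReal.ofReal ((1 - π) * x + π * y) := by
  obtain ⟨χ, hχ, e₀, e₁⟩ := h.2
  refine (iInf₂_le χ hχ).trans ?_
  rw [ofReal_convexCombination hπ hx hy, χ.ess_mixLaw, mul_add, mul_left_comm,
    mul_left_comm (ENNReal.ofReal (1 + ε)) (ENNReal.ofReal π)]
  gcongr

theorem ESSBounds.optESS_iidLaw_left_le (h : ESSBounds μ₀ μ₁ α β x y ε) :
    optESS μ₀ μ₁ (iidLaw μ₀) α β ≤ ENNReal.ofReal (1 + ε) * ENNReal.ofReal x := by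
  obtain ⟨χ, hχ, e₀, -⟩ := h.2
  exact (iInf₂_le χ hχ).trans e₀

theorem ESSBounds.optESS_iidLaw_right_le (h : ESSBounds μ₀ μ₁ α β x y ε) :
    optESS μ₀ μ₁ (iidLaw μ₁) α β ≤ ENNReal.ofReal (1 + ε) * ENNReal.ofReal y := by
  obtain ⟨χ, hχ, -, e₁⟩ := h.2
  exact (iInf₂_le χ hχ).trans e₁

end ESSBounds

theorem convexCombination_pos {π x y : ℝ} (hπ : π ∈ Set.Icc (0 : ℝ) 1) (hx : 0 < x)
    (hy : 0 < y) : 0 < (1 - π) * x + π * y := by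
  rcases hπ.1.eq_or_lt with h | h
  · simpa [← h] using hx
  · exact add_pos_of_nonneg_of_pos (mul_nonneg (sub_nonneg.2 hπ.2) hx.le) (mul_pos h hy)

theorem eventually_le_ofReal_one_add_mul {a b : ℕ → ℝ≥0∞}
    (h : Tendsto (fun m => a m / b m) atTop (𝓝 1)) {δ : ℝ} (hδ : 0 < δ) :
    ∀ᶠ m in atTop, a m ≤ ENNReal.ofReal (1 + δ) * b m := by
  have h1 : (1 : ℝ≥0∞) < ENNReal.ofReal (1 + δ) :=
    ENNReal.one_lt_ofReal.2 (by linarith)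
  filter_upwards [h.eventually_lt_const h1] with m hm
  -- The side conditions are discharged by the constant, so `b m` may be `0` or `⊤`.
  exact (ENNReal.div_le_iff_le_mul (Or.inr ENNReal.ofReal_ne_top)
    (Or.inr (zero_lt_one.trans h1).ne')).1 hm.le

theorem eventually_le_ofReal_mul {a b : ℕ → ℝ≥0∞}
    (h : Tendsto (fun m => a m / b m) atTop (𝓝 0)) {δ : ℝ} (hδ : 0 < δ) :
    ∀ᶠ m in atTop, a m ≤ ENNReal.ofReal δ * b m := by
  have h1 : (0 : ℝ≥0∞) < ENNReal.ofReal δ := ENNReal.ofReal_pos.2 hδ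
  filter_upwards [h.eventually_lt_const h1] with m hm
  exact (ENNReal.div_le_iff_le_mul (Or.inr ENNReal.ofReal_ne_top) (Or.inr h1.ne')).1 hm.le

section Sequences

variable {μ₀ μ₁ : Measure E} [IsProbabilityMeasure μ₀] [IsProbabilityMeasure μ₁]
  {l u : ℕ → ℕ} {α β x y : ℕ → ℝ}

theorem div_mem_Icc_of_le {s m : ℕ} (h : s ≤ m) : (s : ℝ) / m ∈ Set.Icc (0 : ℝ) 1 :=
  ⟨by positivity, div_le_one_of_le₀ (by exact_mod_cast h) (Nat.cast_nonneg m)⟩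

/-- Uniformity is automatic: the threshold in `m` comes from `ESSBounds`, which does not involve
`s`. -/
theorem unifEquiv_optESS (hum : ∀ᶠ m in atTop, u m ≤ m) (hx : ∀ᶠ m in atTop, 0 < x m)
    (hy : ∀ᶠ m in atTop, 0 < y m)
    (h : ∀ ε : ℝ, 0 < ε → ∀ᶠ m in atTop, ESSBounds μ₀ μ₁ (α m) (β m) (x m) (y m) ε) :
    UnifEquiv l u (fun m s => optESS μ₀ μ₁ (mixLaw μ₀ μ₁ ((s : ℝ) / m)) (α m) (β m))
      (fun m s => ENNReal.ofReal ((1 - (s : ℝ) / m) * x m + (s : ℝ) / m * y m)) := by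
  intro ε hε
  filter_upwards [hum, hx, hy, h ε hε] with m hum hx hy h s _ hs
  have hπ := div_mem_Icc_of_le (hs.trans hum)
  have hw := ENNReal.ofReal_pos.2 (convexCombination_pos hπ hx hy)
  rw [ENNReal.le_div_iff_mul_le (Or.inl hw.ne') (Or.inl ENNReal.ofReal_ne_top),
    ENNReal.div_le_iff_le_mul (Or.inl hw.ne') (Or.inl ENNReal.ofReal_ne_top)]
  exact ⟨h.le_optESS_mixLaw hπ hx.le hy.le, h.optESS_mixLaw_le hπ hx.le hy.le⟩

/-- Membership in the class already bounds the quotient below by `1`, so only an upper bound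
relative to the convex combination is needed. The constant `(1 + δ)² + δ` leaves room for the errors
arising in both (ii) and (iii). -/
theorem unifEquiv_ess_optESS (hum : ∀ᶠ m in atTop, u m ≤ m) (hx : ∀ᶠ m in atTop, 0 < x m)
    (hy : ∀ᶠ m in atTop, 0 < y m)
    (h : ∀ ε : ℝ, 0 < ε → ∀ᶠ m in atTop, ESSBounds μ₀ μ₁ (α m) (β m) (x m) (y m) ε)
    {χ : ℕ → SeqTest E} (hχ : ∀ᶠ m in atTop, χ m ∈ testClass μ₀ μ₁ (α m) (β m))
    (hup : ∀ δ : ℝ, 0 < δ → ∀ᶠ m in atTop, ∀ s : ℕ, l m ≤ s → s ≤ u m →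
      (χ m).ess (mixLaw μ₀ μ₁ ((s : ℝ) / m)) ≤ ENNReal.ofReal ((1 + δ) * (1 + δ) + δ) *
        ENNReal.ofReal ((1 - (s : ℝ) / m) * x m + (s : ℝ) / m * y m)) :
    UnifEquiv l u (fun m s => (χ m).ess (mixLaw μ₀ μ₁ ((s : ℝ) / m)))
      (fun m s => optESS μ₀ μ₁ (mixLaw μ₀ μ₁ ((s : ℝ) / m)) (α m) (β m)) := by
  intro ε hε
  -- Small enough that `(1 + δ)² + δ ≤ (1 + ε) (1 - δ)`.
  obtain ⟨δ, hδ, hδ1, hδε⟩ : ∃ δ : ℝ, 0 < δ ∧ 8 * δ ≤ 1 ∧ 8 * δ ≤ ε :=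
    ⟨min ε 1 / 8, by positivity, by linarith [min_le_right ε 1], by linarith [min_le_left ε 1]⟩
  filter_upwards [hum, hx, hy, h δ hδ, hχ, hup δ hδ] with m hum hx hy h hχ hup s hls hs
  have hπ := div_mem_Icc_of_le (hs.trans hum)
  have hw := ENNReal.ofReal_pos.2 (convexCombination_pos hπ hx hy)
  have hlo := h.le_optESS_mixLaw hπ hx.le hy.le
  have hhi := h.optESS_mixLaw_le hπ hx.le hy.le
  set w := ENNReal.ofReal ((1 - (s : ℝ) / m) * x m + (s : ℝ) / m * y m)
  set o := optESS μ₀ μ₁ (mixLaw μ₀ μ₁ ((s : ℝ) / m)) (α m) (β m) with ho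
  have hotop : o ≠ ⊤ :=
    (hhi.trans_lt (ENNReal.mul_lt_top ENNReal.ofReal_lt_top ENNReal.ofReal_lt_top)).ne
  have hopos : o ≠ 0 :=
    ((ENNReal.mul_pos (ENNReal.ofReal_pos.2 (by linarith)).ne' hw.ne').trans_le hlo).ne'
  rw [ENNReal.le_div_iff_mul_le (Or.inl hopos) (Or.inl hotop),
    ENNReal.div_le_iff_le_mul (Or.inl hopos) (Or.inl hotop)]
  constructor
  · calc ENNReal.ofReal (1 - ε) * o ≤ 1 * o := by
          gcongr
          exact ENNReal.ofReal_le_one.2 (by linarith)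
      _ = o := one_mul o
      _ ≤ _ := iInf₂_le _ hχ
  · calc _ ≤ ENNReal.ofReal ((1 + δ) * (1 + δ) + δ) * w := hup s hls hs
      _ ≤ ENNReal.ofReal ((1 + ε) * (1 - δ)) * w := by
          gcongr
          nlinarith
      _ = ENNReal.ofReal (1 + ε) * (ENNReal.ofReal (1 - δ) * w) := by
          rw [ENNReal.ofReal_mul (by linarith), mul_assoc]
      _ ≤ ENNReal.ofReal (1 + ε) * o := by gcongr

theorem unifEquiv_ess_of_tendsto_of_tendsto (hum : ∀ᶠ m in atTop, u m ≤ m)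
    (hx : ∀ᶠ m in atTop, 0 < x m) (hy : ∀ᶠ m in atTop, 0 < y m)
    (h : ∀ ε : ℝ, 0 < ε → ∀ᶠ m in atTop, ESSBounds μ₀ μ₁ (α m) (β m) (x m) (y m) ε)
    {χ : ℕ → SeqTest E} (hχ : ∀ᶠ m in atTop, χ m ∈ testClass μ₀ μ₁ (α m) (β m))
    (hχ₀ : Tendsto (fun m => (χ m).ess (iidLaw μ₀) / optESS μ₀ μ₁ (iidLaw μ₀) (α m) (β m))
      atTop (𝓝 1))
    (hχ₁ : Tendsto (fun m => (χ m).ess (iidLaw μ₁) / optESS μ₀ μ₁ (iidLaw μ₁) (α m) (β m))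
      atTop (𝓝 1)) :
    UnifEquiv l u (fun m s => (χ m).ess (mixLaw μ₀ μ₁ ((s : ℝ) / m)))
      (fun m s => optESS μ₀ μ₁ (mixLaw μ₀ μ₁ ((s : ℝ) / m)) (α m) (β m)) := by
  refine unifEquiv_ess_optESS hum hx hy h hχ fun δ hδ => ?_
  filter_upwards [hum, hx, hy, h δ hδ, eventually_le_ofReal_one_add_mul hχ₀ hδ,
    eventually_le_ofReal_one_add_mul hχ₁ hδ] with m hum hx hy h e₀ e₁ s _ hs
  have hπ := div_mem_Icc_of_le (hs.trans hum)
  have hδ' : ENNReal.ofReal ((1 + δ) * (1 + δ)) ≤ ENNReal.ofReal ((1 + δ) * (1 + δ) + δ) :=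
    ENNReal.ofReal_le_ofReal (by linarith)
  have hmul : ENNReal.ofReal ((1 + δ) * (1 + δ)) =
      ENNReal.ofReal (1 + δ) * ENNReal.ofReal (1 + δ) := ENNReal.ofReal_mul (by linarith)
  have f₀ : (χ m).ess (iidLaw μ₀) ≤
      ENNReal.ofReal ((1 + δ) * (1 + δ) + δ) * ENNReal.ofReal (x m) := by
    calc _ ≤ ENNReal.ofReal (1 + δ) * (ENNReal.ofReal (1 + δ) * ENNReal.ofReal (x m)) :=
          e₀.trans (mul_le_mul_right h.optESS_iidLaw_left_le _)
      _ ≤ _ := by rw [← mul_assoc, ← hmul]; gcongr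
  have f₁ : (χ m).ess (iidLaw μ₁) ≤
      ENNReal.ofReal ((1 + δ) * (1 + δ) + δ) * ENNReal.ofReal (y m) := by
    calc _ ≤ ENNReal.ofReal (1 + δ) * (ENNReal.ofReal (1 + δ) * ENNReal.ofReal (y m)) :=
          e₁.trans (mul_le_mul_right h.optESS_iidLaw_right_le _)
      _ ≤ _ := by rw [← mul_assoc, ← hmul]; gcongr
  rw [ofReal_convexCombination hπ hx.le hy.le, (χ m).ess_mixLaw, mul_add, mul_left_comm,
    mul_left_comm (ENNReal.ofReal ((1 + δ) * (1 + δ) + δ)) (ENNReal.ofReal ((s : ℝ) / m))]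
  gcongr

/-- Rests on `s / u ≤ 1` and `m - u ≤ m - s`. It explains the threshold in (iii): weighted by `s /
m`, that threshold never exceeds the `P₀` term with weight `1 - s / m`. -/
theorem div_mul_sub_mul_div_le {s u m : ℕ} (hs : s ≤ u) (hu : u ≤ m) (hu0 : 0 < u) {b : ℝ}
    (hb : 0 ≤ b) : (s : ℝ) / m * (((m : ℝ) - u) * b / u) ≤ (1 - (s : ℝ) / m) * b := by
  have hu' : (0 : ℝ) < u := by exact_mod_cast hu0
  have hm' : (0 : ℝ) < m := by exact_mod_cast hu0.trans_le hu
  have hsu : (s : ℝ) ≤ u := by exact_mod_cast hs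
  have hum : (u : ℝ) ≤ m := by exact_mod_cast hu
  have e1 : (s : ℝ) / m * (((m : ℝ) - u) * b / u) = (s / u) * (((m : ℝ) - u) * b / m) := by
    field_simp
  have e2 : (1 - (s : ℝ) / m) * b = ((m : ℝ) - s) * b / m := by field_simp
  rw [e1, e2]
  have h0 : 0 ≤ ((m : ℝ) - u) * b / m :=
    div_nonneg (mul_nonneg (sub_nonneg.2 hum) hb) hm'.le
  refine (mul_le_of_le_one_left h0 ((div_le_one hu').2 hsu)).trans ?_
  gcongr

theorem unifEquiv_ess_of_tendsto_of_tendsto_zero (hum : ∀ᶠ m in atTop, u m ≤ m)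
    (hu : ∀ᶠ m in atTop, 0 < u m)
    (hx : ∀ᶠ m in atTop, 0 < x m) (hy : ∀ᶠ m in atTop, 0 < y m)
    (h : ∀ ε : ℝ, 0 < ε → ∀ᶠ m in atTop, ESSBounds μ₀ μ₁ (α m) (β m) (x m) (y m) ε)
    {χ : ℕ → SeqTest E} (hχ : ∀ᶠ m in atTop, χ m ∈ testClass μ₀ μ₁ (α m) (β m))
    (hχ₀ : Tendsto (fun m => (χ m).ess (iidLaw μ₀) / optESS μ₀ μ₁ (iidLaw μ₀) (α m) (β m))
      atTop (𝓝 1))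
    {I : ℝ} (hI : 0 < I)
    (hχ₁ : Tendsto (fun m => (χ m).ess (iidLaw μ₁) /
      ENNReal.ofReal (((m : ℝ) - u m) * (I * x m) / u m)) atTop (𝓝 0)) :
    UnifEquiv l u (fun m s => (χ m).ess (mixLaw μ₀ μ₁ ((s : ℝ) / m)))
      (fun m s => optESS μ₀ μ₁ (mixLaw μ₀ μ₁ ((s : ℝ) / m)) (α m) (β m)) := by
  refine unifEquiv_ess_optESS hum hx hy h hχ fun δ hδ => ?_
  filter_upwards [hum, hu, hx, hy, h δ hδ, eventually_le_ofReal_one_add_mul hχ₀ hδ,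
    eventually_le_ofReal_mul hχ₁ (div_pos hδ hI)] with m hum hu hx hy h e₀ e₁ s _ hs
  have hπ := div_mem_Icc_of_le (hs.trans hum)
  have hπ' : 0 ≤ 1 - (s : ℝ) / m := sub_nonneg.2 hπ.2
  have f₀ : (χ m).ess (iidLaw μ₀) ≤ ENNReal.ofReal ((1 + δ) * (1 + δ) * x m) := by
    calc _ ≤ ENNReal.ofReal (1 + δ) * (ENNReal.ofReal (1 + δ) * ENNReal.ofReal (x m)) :=
          e₀.trans (mul_le_mul_right h.optESS_iidLaw_left_le _)
      _ = _ := by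
        rw [mul_assoc, ENNReal.ofReal_mul (by linarith), ENNReal.ofReal_mul (by linarith)]
  rw [← ENNReal.ofReal_mul (by positivity)] at e₁
  rw [(χ m).ess_mixLaw, ← ENNReal.ofReal_mul (by positivity)]
  calc _ ≤ ENNReal.ofReal (1 - (s : ℝ) / m) * ENNReal.ofReal ((1 + δ) * (1 + δ) * x m) +
        ENNReal.ofReal ((s : ℝ) / m) *
          ENNReal.ofReal (δ / I * (((m : ℝ) - u m) * (I * x m) / u m)) := by gcongr
    _ = ENNReal.ofReal ((1 - (s : ℝ) / m) * ((1 + δ) * (1 + δ) * x m) +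
        (s : ℝ) / m * (δ / I * (((m : ℝ) - u m) * (I * x m) / u m))) := by
      have : (0 : ℝ) ≤ (m : ℝ) - u m := sub_nonneg.2 (by exact_mod_cast hum)
      rw [← ENNReal.ofReal_mul hπ', ← ENNReal.ofReal_mul hπ.1, ENNReal.ofReal_add] <;>
        positivity
    _ ≤ _ := by
      refine ENNReal.ofReal_le_ofReal ?_
      -- The `P₁` contribution is at most `δ` times the `P₀` part of the target; the `P₁` part of
      -- the target is nonnegative and is dropped.
      have h1 := mul_le_mul_of_nonneg_left
        (div_mul_sub_mul_div_le hs hum hu (b := I * x m) (by positivity)) (div_pos hδ hI).le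
      have h2 : δ / I * ((1 - (s : ℝ) / m) * (I * x m)) = δ * ((1 - (s : ℝ) / m) * x m) := by
        field_simp
      rw [h2] at h1
      have h3 : 0 ≤ ((1 + δ) * (1 + δ) + δ) * ((s : ℝ) / m * y m) :=
        mul_nonneg (by positivity) (mul_nonneg hπ.1 hy.le)
      linarith

end Sequences

end AsymptoticOptimality

/-! ### Densities and divergences in terms of the log-likelihood ratio -/

section LogLikelihoodRatio

open InformationTheory

variable {E : Type*} [MeasurableSpace E]

theorem withDensity_exp_llr {μ ν : Measure E} [IsFiniteMeasure μ] [IsFiniteMeasure ν]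
    (hμν : μ ≪ ν) (hνμ : ν ≪ μ) :
    ν.withDensity (fun x => ENNReal.ofReal (Real.exp (llr μ ν x))) = μ := by
  rw [← Measure.withDensity_rnDeriv_eq μ ν hμν]
  refine withDensity_congr_ae ?_
  rw [Measure.withDensity_rnDeriv_eq μ ν hμν]
  filter_upwards [exp_llr_of_ac' μ ν hνμ, Measure.rnDeriv_ne_top μ ν] with x hx hx'
  rw [hx, ENNReal.ofReal_toReal hx']

/-- Finite divergence contains absolute continuity and integrability; for probability measures the
mass correction in `klDiv` vanishes. -/
theorem integral_llr_eq_of_klDiv_eq {μ ν : Measure E} [IsProbabilityMeasure μ]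
    [IsProbabilityMeasure ν] {I : ℝ} (hI : 0 ≤ I) (h : klDiv μ ν = ENNReal.ofReal I) :
    μ ≪ ν ∧ Integrable (llr μ ν) μ ∧ ∫ x, llr μ ν x ∂μ = I := by
  obtain ⟨hac, hint⟩ := klDiv_ne_top_iff.1 (h ▸ ENNReal.ofReal_ne_top)
  refine ⟨hac, hint, ?_⟩
  rw [← toReal_klDiv_of_measure_eq hac (by simp), h, ENNReal.toReal_ofReal hI]

end LogLikelihoodRatio

/-! ### The main theorem -/

theorem mainTheorem9 {E : Type*} [MeasurableSpace E] (ν : Measure E) [SigmaFinite ν]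
    (f₀ f₁ : E → ℝ≥0∞) (hf₀ : Measurable f₀) (hf₁ : Measurable f₁)
    [IsProbabilityMeasure (ν.withDensity f₀)] [IsProbabilityMeasure (ν.withDensity f₁)]
    (I₀ I₁ : ℝ) (hI₀ : 0 < I₀) (hI₁ : 0 < I₁)
    (hKL₀ : InformationTheory.klDiv (ν.withDensity f₀) (ν.withDensity f₁) = ENNReal.ofReal I₀)
    (hKL₁ : InformationTheory.klDiv (ν.withDensity f₁) (ν.withDensity f₀) = ENNReal.ofReal I₁)
    (l u κ ι : ℕ → ℕ)
    (hlu : ∀ᶠ m in atTop, l m ≤ u m ∧ u m ≤ m)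
    (hι : ∀ᶠ m in atTop, 1 ≤ ι m ∧ ι m < u m)
    (hκ : ∀ᶠ m in atTop, 1 ≤ κ m ∧ κ m < m - l m)
    (hu : Tendsto u atTop atTop)
    (hl : Tendsto (fun m => m - l m) atTop atTop)
    (hιu : Tendsto (fun m => (ι m : ℝ) / (u m : ℝ)) atTop (𝓝 0))
    (hκl : Tendsto (fun m => (κ m : ℝ) / ((m : ℝ) - (l m : ℝ))) atTop (𝓝 0))
    (χ : ℝ → ℝ → SeqTest E)
    (hχ : ∀ α ∈ Set.Ioo (0 : ℝ) 1, ∀ β ∈ Set.Ioo (0 : ℝ) 1,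
      χ α β ∈ testClass (ν.withDensity f₀) (ν.withDensity f₁) α β) :
    (∀ α ∈ Set.Ioo (0 : ℝ) (1 / 2), ∀ β ∈ Set.Ioo (0 : ℝ) (1 / 2),
      UnifEquiv l u
        (fun m s => optESS (ν.withDensity f₀) (ν.withDensity f₁)
          (mixLaw (ν.withDensity f₀) (ν.withDensity f₁) ((s : ℝ) / m))
          (alphaG l κ α m) (betaG u ι β m))
        (fun m s => ENNReal.ofReal
          ((1 - (s : ℝ) / m) * (Real.log ((u m : ℝ) / ι m) / I₀) +
            (s : ℝ) / m * (Real.log (((m : ℝ) - l m) / κ m) / I₁)))) ∧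
    ((∀ α ∈ Set.Ioo (0 : ℝ) (1 / 2), ∀ β ∈ Set.Ioo (0 : ℝ) (1 / 2),
        Tendsto (fun m => (χ (alphaG l κ α m) (betaG u ι β m)).ess (iidLaw (ν.withDensity f₀)) /
          optESS (ν.withDensity f₀) (ν.withDensity f₁) (iidLaw (ν.withDensity f₀))
            (alphaG l κ α m) (betaG u ι β m)) atTop (𝓝 1) ∧
        Tendsto (fun m => (χ (alphaG l κ α m) (betaG u ι β m)).ess (iidLaw (ν.withDensity f₁)) /
          optESS (ν.withDensity f₀) (ν.withDensity f₁) (iidLaw (ν.withDensity f₁))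
            (alphaG l κ α m) (betaG u ι β m)) atTop (𝓝 1)) →
      HighDimOptimal (ν.withDensity f₀) (ν.withDensity f₁) l u κ ι χ) ∧
    ((∀ α ∈ Set.Ioo (0 : ℝ) (1 / 2), ∀ β ∈ Set.Ioo (0 : ℝ) (1 / 2),
        Tendsto (fun m => (χ (alphaG l κ α m) (betaG u ι β m)).ess (iidLaw (ν.withDensity f₀)) /
          optESS (ν.withDensity f₀) (ν.withDensity f₁) (iidLaw (ν.withDensity f₀))
            (alphaG l κ α m) (betaG u ι β m)) atTop (𝓝 1) ∧
        Tendsto (fun m => (χ (alphaG l κ α m) (betaG u ι β m)).ess (iidLaw (ν.withDensity f₁)) /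
          ENNReal.ofReal (((m : ℝ) - u m) * Real.log ((u m : ℝ) / ι m) / u m)) atTop (𝓝 0)) →
      HighDimOptimal (ν.withDensity f₀) (ν.withDensity f₁) l u κ ι χ) := by
  set μ₀ := ν.withDensity f₀ with hμ₀
  set μ₁ := ν.withDensity f₁ with hμ₁
  obtain ⟨hac₀, hint₀, hval₀⟩ := integral_llr_eq_of_klDiv_eq hI₀.le hKL₀
  obtain ⟨hac₁, hint₁, hval₁⟩ := integral_llr_eq_of_klDiv_eq hI₁.le hKL₁
  -- The two divergences are finite, so the measures are mutually absolutely continuous, and one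
  -- function `llr μ₀ μ₁` serves both hypotheses up to sign and null sets.
  have hneg : llr μ₁ μ₀ =ᵐ[μ₁] fun x => -llr μ₀ μ₁ x := (neg_llr hac₁).mono fun x hx => by
    simp only [← hx, Pi.neg_apply, neg_neg]
  have hneg' : llr μ₁ μ₀ =ᵐ[μ₀] fun x => -llr μ₀ μ₁ x := (neg_llr hac₀).symm
  have hZ₁ : Integrable (llr μ₀ μ₁) μ₁ := by
    simpa using ((integrable_congr hneg).1 hint₁).neg
  have hval₁' : ∫ x, -llr μ₀ μ₁ x ∂μ₁ = I₁ := by rw [← integral_congr_ae hneg, hval₁]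
  have h₀ : μ₀ = μ₁.withDensity fun x => ENNReal.ofReal (Real.exp (llr μ₀ μ₁ x)) :=
    (withDensity_exp_llr hac₀ hac₁).symm
  have h₁ : μ₁ = μ₀.withDensity fun x => ENNReal.ofReal (Real.exp (-llr μ₀ μ₁ x)) :=
    (withDensity_exp_llr hac₁ hac₀).symm.trans (withDensity_congr_ae (hneg'.mono fun x hx =>
      congrArg (fun t => ENNReal.ofReal (Real.exp t)) hx))
  have hlm : ∀ᶠ m in atTop, l m ≤ m := hlu.mono fun m hm => hm.1.trans hm.2
  have hum : ∀ᶠ m in atTop, u m ≤ m := hlu.mono fun m hm => hm.2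
  have hu0 : ∀ᶠ m in atTop, 0 < u m := hι.mono fun m hm => (Nat.zero_le _).trans_lt hm.2
  have hκl' : Tendsto (fun m => (κ m : ℝ) / ((m - l m : ℕ) : ℝ)) atTop (𝓝 0) :=
    hκl.congr' (hlm.mono fun m hm => by simp only [Nat.cast_sub hm])
  have hA : ∀ α ∈ Set.Ioo (0 : ℝ) (1 / 2), (∀ᶠ m in atTop, alphaG l κ α m ∈ Set.Ioo (0 : ℝ) 1) ∧
      Tendsto (alphaG l κ α) atTop (𝓝 0) ∧
      Tendsto (fun m : ℕ => Real.log (((m : ℝ) - l m) / κ m)) atTop atTop ∧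
      Tendsto (fun m : ℕ => Real.log (1 / alphaG l κ α m) / Real.log (((m : ℝ) - l m) / κ m)) atTop
        (𝓝 1) := by
    intro α hα
    obtain ⟨a1, a2, a3, a4⟩ := tendsto_log_binomLevel (n := fun m => m - l m) hα hκ hκl'
    refine ⟨a1, a2, a3.congr' ?_, a4.congr' ?_⟩
    · exact hlm.mono fun m hm => by simp only [Nat.cast_sub hm]
    · exact hlm.mono fun m hm => by simp only [Nat.cast_sub hm]; rfl
  have hB : ∀ β ∈ Set.Ioo (0 : ℝ) (1 / 2), (∀ᶠ m in atTop, betaG u ι β m ∈ Set.Ioo (0 : ℝ) 1) ∧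
      Tendsto (betaG u ι β) atTop (𝓝 0) ∧
      Tendsto (fun m : ℕ => Real.log ((u m : ℝ) / ι m)) atTop atTop ∧
      Tendsto (fun m : ℕ => Real.log (1 / betaG u ι β m) / Real.log ((u m : ℝ) / ι m)) atTop
        (𝓝 1) := fun β hβ => tendsto_log_binomLevel hβ hι hιu
  -- The divergence of the two logarithms does not involve the levels; any admissible value extracts
  -- it from `hA` and `hB`.
  have hquarter : (1 / 4 : ℝ) ∈ Set.Ioo (0 : ℝ) (1 / 2) := by norm_num
  have hx : ∀ᶠ m : ℕ in atTop, 0 < Real.log ((u m : ℝ) / ι m) / I₀ :=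
    ((hB _ hquarter).2.2.1.eventually_gt_atTop 0).mono fun m hm => div_pos hm hI₀
  have hy : ∀ᶠ m : ℕ in atTop, 0 < Real.log (((m : ℝ) - l m) / κ m) / I₁ :=
    ((hA _ hquarter).2.2.1.eventually_gt_atTop 0).mono fun m hm => div_pos hm hI₁
  have hbounds : ∀ α ∈ Set.Ioo (0 : ℝ) (1 / 2), ∀ β ∈ Set.Ioo (0 : ℝ) (1 / 2), ∀ ε : ℝ, 0 < ε →
      ∀ᶠ m in atTop, ESSBounds μ₀ μ₁ (alphaG l κ α m) (betaG u ι β m)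
        (Real.log ((u m : ℝ) / ι m) / I₀) (Real.log (((m : ℝ) - l m) / κ m) / I₁) ε := by
    intro α hα β hβ ε hε
    obtain ⟨a1, a2, a3, a4⟩ := hA α hα
    obtain ⟨b1, b2, b3, b4⟩ := hB β hβ
    exact eventually_essBounds (measurable_llr μ₀ μ₁) h₁ h₀ hint₀ hZ₁ hI₀ hI₁ hval₀ hval₁'
      a1 b1 a2 b2 a3 b3 a4 b4 hε
  have hmem : ∀ α ∈ Set.Ioo (0 : ℝ) (1 / 2), ∀ β ∈ Set.Ioo (0 : ℝ) (1 / 2), ∀ᶠ m in atTop,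
      χ (alphaG l κ α m) (betaG u ι β m) ∈
        testClass μ₀ μ₁ (alphaG l κ α m) (betaG u ι β m) := fun α hα β hβ =>
    ((hA α hα).1.and (hB β hβ).1).mono fun m hm => hχ _ hm.1 _ hm.2
  refine ⟨fun α hα β hβ => unifEquiv_optESS hum hx hy (hbounds α hα β hβ),
    fun H α hα β hβ => ?_, fun H α hα β hβ => ?_⟩
  · exact unifEquiv_ess_of_tendsto_of_tendsto hum hx hy (hbounds α hα β hβ) (hmem α hα β hβ)
      (H α hα β hβ).1 (H α hα β hβ).2
  · refine unifEquiv_ess_of_tendsto_of_tendsto_zero hum hu0 hx hy (hbounds α hα β hβ)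
      (hmem α hα β hβ) (H α hα β hβ).1 hI₀ ?_
    refine (H α hα β hβ).2.congr fun m => ?_
    rw [mul_div_cancel₀ _ hI₀.ne']
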